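/- Let $\beta\in\mathbb R$ and let $t,k\ge 1$ and $n\ge 0$ be integers. For $N\ge 1$ let $\mathfrak p_N=\{\{i,j\}:1\le i<j\le N\}$, let $g=(g_e)_{e\in\mathfrak p_N}$ be independent standard Gaussian random variables, write $g_{ij}=g_{ji}=g_{\{i,j\}}$ for $i\ne j$ and $\mathfrak d_{ij}=\partial/\partial g_{ij}$, and set $g_{ii}=0$, $\mathfrak d_{ii}=0$. Let $m^{(1)}$ be a random vector in $[-1,1]^N$ that is independent of $g$ (for instance deterministic), let $m^{(0)}=0$, and for $h\in\mathbb R$ and $k\ge 1$ define recursively $$m^{(k+1)}_i=\tanh\Big(h+\frac{\beta}{\sqrt N}\sum_{j=1}^N g_{ij}m^{(k)}_j-\mathrm{On}^{(k)}_i\Big),\qquad 1\le i\le N,$$ where, for all $k\ge1$ and $1\le i\le N$, the correction $\mathrm{On}^{(k)}_i$ is given by either of the following two choices: $$\text{(I)}\quad \mathrm{On}^{(k)}_i=\beta^2\Big(1-\frac1N\sum_{j=1}^N (m^{(k)}_j)^2\Big)m^{(k-1)}_i,\qquad\qquad \text{(II)}\quad \mathrm{On}^{(k)}_i=\frac{\beta}{\sqrt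 N}\sum_{j=1}^N\mathfrak d_{ij}m^{(k)}_j .$$ All derivatives are taken with respect to $g$, with the starting value $m^{(1)}$ held fixed. For a multi-index $\alpha\in\mathbb N_0^{\mathfrak p_N}$ put $|\alpha|=\sum_{e}\alpha_e$ and $\partial_\alpha=\prod_{e\in\mathfrak p_N}(\partial/\partial g_e)^{\alpha_e}$. Identify $\alpha$ with the multigraph with $\alpha_{\{i,j\}}$ edges between $i$ and $j$ and with vertex set $\{i:\alpha_{\{i,j\}}>0\text{ for some }j\}$, and let $\mathcal C_\alpha(p)$ be the number of its connected components that do not contain $p$. Theorem. For each of the choices (I) and (II), there is a constant $C=C_{n,t,k,\beta}\in(0,\infty)$ such that, for all $N\ge 1$, all $h\in\mathbb R$, all $p\in\{1,\dots,N\}$, all $\alpha\in\mathbb N_0^{\mathfrak p_N}$ with $|\alpha|=n$ and all starting values $m^{(1)}$ as above, $m^{(k)}_p$ is a smooth ($C^\infty$) function of $g$ for every fixed value of $m^{(1)}$, the random variable below is integrable, and $$\mathbb E\Big[\Big(\sqrt N^{\,|\alpha|+\mathcal C_\alpha(p)}\,\partial_\alpha m^{(k)}_p\Big)^{2t}\Big]\le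 C .$$ -/

import Mathlib

open MeasureTheory ProbabilityTheory

namespace TAP

/-- The unordered pairs `{i, j}` with `i ≠ j` of sites; they index the disorder. -/
abbrev Pair (N : ℕ) : Type := {e : Sym2 (Fin N) // ¬ e.IsDiag}

/-- The pair `{i, j}` for `i ≠ j`. -/
def mkPair {N : ℕ} (i j : Fin N) (hij : i ≠ j) : Pair N :=
  ⟨s(i, j), fun hd => hij (Sym2.mk_isDiag_iff.mp hd)⟩

/-- A realization `(g_e)` of the disorder, one real number for every pair of sites. -/
abbrev Disorder (N : ℕ) : Type := Pair N → ℝ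

/-- The symmetric coupling matrix `g_{ij} = g_{ji}`, with `g_{ii} = 0`. -/
noncomputable def coupling {N : ℕ} (g : Disorder N) (i j : Fin N) : ℝ :=
  if hij : i ≠ j then g (mkPair i j hij) else 0

/-- The partial derivative with respect to the coordinate `g_e`. -/
noncomputable def partialDeriv {N : ℕ} (e : Pair N) (F : Disorder N → ℝ) : Disorder N → ℝ :=
  fun g => lineDeriv ℝ F g (Pi.single e 1)

/-- The partial derivative with respect to `g_{ij}`, with the convention that it vanishes
for `i = j`. -/
noncomputable def siteDeriv {N : ℕ} (i j : Fin N) (F : Disorder N → ℝ) : Disorder N → ℝ :=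
  if hij : i ≠ j then partialDeriv (mkPair i j hij) F else fun _ => 0

/-- The two choices of the Onsager correction. -/
inductive OnsagerChoice : Type
  | classical
  | recentering

/-- The Onsager correction at site `i`, as a function of the disorder: `mPrev` and `m` are the
iterates number `k - 1` and `k` as functions of the disorder. The classical choice is
`β² (1 - N⁻¹ ∑ j, m_j²) mPrev_i`, the other one is `β / √N * ∑ j, ∂ m_j / ∂ g_{ij}`. -/
noncomputable def onsager {N : ℕ} (c : OnsagerChoice) (β : ℝ)
    (mPrev m : Disorder N → Fin N → ℝ) (g : Disorder N) (i : Fin N) : ℝ :=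
  match c with
  | OnsagerChoice.classical => β ^ 2 * (1 - (1 / (N : ℝ)) * ∑ j, m g j ^ 2) * mPrev g i
  | OnsagerChoice.recentering =>
      β / Real.sqrt N * ∑ j, siteDeriv i j (fun g' => m g' j) g

/-- The iterates `m^(k)` as functions of the disorder, for a fixed starting value `m^(1) = m₁`.
The value at `k = 0` is the second starting value `m^(0) = 0` of the classical choice; for the
other choice it is a placeholder on which the later iterates do not depend. -/
noncomputable def iterate {N : ℕ} (c : OnsagerChoice) (β h : ℝ) (m₁ : Fin N → ℝ) :
    ℕ → Disorder N → Fin N → ℝ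
  | 0 => fun _ _ => 0
  | 1 => fun _ i => m₁ i
  | k + 2 => fun g i =>
      Real.tanh (h + (β / Real.sqrt N * ∑ j, coupling g i j * iterate c β h m₁ (k + 1) g j
        - onsager c β (iterate c β h m₁ k) (iterate c β h m₁ (k + 1)) g i))

/-- Multi-indices over the pairs of sites, that is, multigraphs without loops on the sites. -/
abbrev MultiIndex (N : ℕ) : Type := Pair N → ℕ

/-- The order `|α|`. -/
def order {N : ℕ} (α : MultiIndex N) : ℕ := ∑ e, α e

/-- The mixed partial derivative `∂_α = ∏ e, (∂ / ∂ g_e) ^ α_e`. The factors are applied along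
some enumeration of the pairs, which does not matter for smooth functions. -/
noncomputable def multiDeriv {N : ℕ} (α : MultiIndex N) (F : Disorder N → ℝ) :
    Disorder N → ℝ :=
  (Finset.univ : Finset (Pair N)).toList.foldr (fun e H => (partialDeriv e)^[α e] H) F

/-- The adjacency relation of the multigraph `α` (multiplicities are irrelevant for
connectedness). -/
def graph {N : ℕ} (α : MultiIndex N) : SimpleGraph (Fin N) where
  Adj i j := ∃ e : Pair N, e.1 = s(i, j) ∧ 0 < α e
  symm := ⟨fun i j ⟨e, he, hα⟩ => ⟨e, he.trans Sym2.eq_swap, hα⟩⟩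
  loopless := ⟨fun i ⟨e, he, _⟩ => e.2 (by rw [he]; exact Sym2.mk_isDiag_iff.mpr rfl)⟩

/-- The number of connected components of the multigraph `α` that do not contain `p`. The
vertices of the multigraph are the endpoints of its edges only. -/
noncomputable def componentsAvoiding {N : ℕ} (α : MultiIndex N) (p : Fin N) : ℕ :=
  Nat.card {c : ((graph α).induce (graph α).support).ConnectedComponent //
    ∀ v ∈ c.supp, (v : Fin N) ≠ p}

end TAP

/-! The scaling by `√N ^ (|α| + C_α(p))` is chosen so that the vectors whose scaled derivatives of
all orders are bounded in all `L^q`, uniformly in `N`, `p`, `h` and the starting value, form a class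
(`Good`) that is closed under every operation of the recursion. Constant vectors with entries in
`[-1, 1]` belong to it, so induction gives the bound for a fixed start (`good_iterate`);
independence and Fubini then cover random starts.

For products, closure rests on the Leibniz rule and the subadditivity of the component count
(`compCount_le_add`). For `tanh` it follows from `tanh' = 1 - tanh²` by induction on the order of
differentiation. For sums over sites one compares the graph of the derivatives `L` with base point
`p` to the graph with extra edges from `p` and a new base point `j` (`compCount_le_compCount_star`).
Each new end point, and `j`, costs a component only if it is already a vertex of `L`; otherwise it
leaves a spare factor `N^(-1/2)`. The squares of these weights sum to at most `2|L| + 1`, which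
settles site averages and the sum `N^(-1/2) ∑ ∂_{pl} F_l`.

The sum `N^(-1/2) ∑ g_{pl} F_l` cannot be bounded term by term. After `∂_L` is commuted past the
coefficients, it is a Gaussian divergence plus a trace of derivatives of the previous kind. The
divergence is controlled by a dimension-free inequality of Meyer type (`exists_nrm_gaussDiv_le`):
integration by parts expresses a moment of `δ(u)` through a moment of half the order of `|u|² +
tr((Du)²) + δ(u·∇u)`, and one iterates. -/

namespace GaussSpace

open scoped ENNReal

/-- The standard Gaussian measure on `E → ℝ`. -/
noncomputable def stdMeasure (E : Type*) [Fintype E] : Measure (E → ℝ) :=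
  Measure.pi fun _ => gaussianReal 0 1

/-! ### Temperate growth and Gaussian moments. -/

section Moments

variable {E : Type*} [Fintype E]

instance : IsProbabilityMeasure (stdMeasure E) := by
  unfold stdMeasure; infer_instance

theorem holderTriple_two_mul (q : ℝ≥0∞) : ENNReal.HolderTriple (2 * q) (2 * q) q where
  inv_add_inv_eq_inv := by
    rw [ENNReal.mul_inv (by simp) (by simp), ← add_mul, ENNReal.inv_two_add_inv_two, one_mul]

theorem memLp_eval (e : E) {q : ℝ≥0∞} (hq : q ≠ ∞) :
    MemLp (fun x : E → ℝ => x e) q (stdMeasure E) := by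
  have h := (measurePreserving_eval (fun _ : E => gaussianReal 0 1) e)
  exact (memLp_id_gaussianReal' (μ := 0) (v := 1) q hq).comp_measurePreserving h

@[fun_prop]
theorem temperate_eval (e : E) : (fun g : E → ℝ => g e).HasTemperateGrowth :=
  (ContinuousLinearMap.proj (R := ℝ) (φ := fun _ : E => ℝ) e).hasTemperateGrowth

theorem memLp_one_add_norm_pow (k : ℕ) {q : ℝ≥0∞} (hq : q ≠ ∞) :
    MemLp (fun x : E → ℝ => (1 + ‖x‖) ^ k) q (stdMeasure E) := by
  have h1 : ∀ {q : ℝ≥0∞}, q ≠ ∞ → MemLp (fun x : E → ℝ => 1 + ‖x‖) q (stdMeasure E) := by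
    intro q hq
    have h2 : MemLp (fun x : E → ℝ => 1 + ∑ e, ‖x e‖) q (stdMeasure E) :=
      (memLp_const (1 : ℝ)).add (memLp_finsetSum _ fun e _ => (memLp_eval e hq).norm)
    refine h2.mono' (by fun_prop) (ae_of_all _ fun x => ?_)
    rw [Real.norm_of_nonneg (by positivity)]
    gcongr
    refine (pi_norm_le_iff_of_nonneg (by positivity)).2 fun i => ?_
    exact Finset.single_le_sum (f := fun e => ‖x e‖) (fun _ _ => norm_nonneg _)
      (Finset.mem_univ i)
  induction k generalizing q with
  | zero => simpa using memLp_const (1 : ℝ)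
  | succ k ih =>
    have : ENNReal.HolderTriple (2 * q) (2 * q) q := holderTriple_two_mul q
    have hq2 : 2 * q ≠ ∞ := ENNReal.mul_ne_top (by simp) hq
    have := MemLp.mul' (r := q) (h1 hq2) (ih hq2)
    simpa [pow_succ] using this

theorem memLp_of_temperate {F : (E → ℝ) → ℝ} (hF : F.HasTemperateGrowth) {q : ℝ≥0∞}
    (hq : q ≠ ∞) : MemLp F q (stdMeasure E) := by
  obtain ⟨k, C, h⟩ := hF.2 0
  refine ((memLp_one_add_norm_pow k hq).const_mul C).mono'
    hF.1.continuous.aestronglyMeasurable (ae_of_all _ fun x => ?_)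
  simpa using h x

theorem integrable_of_temperate {F : (E → ℝ) → ℝ} (hF : F.HasTemperateGrowth) :
    Integrable F (stdMeasure E) :=
  memLp_one_iff_integrable.1 (memLp_of_temperate hF ENNReal.one_ne_top)

end Moments

/-! ### Calculus of partial derivatives. -/

section Derivatives

variable {E : Type*} [DecidableEq E]

/-- The partial derivative in the coordinate `e`. -/
noncomputable def pd (e : E) (F : (E → ℝ) → ℝ) : (E → ℝ) → ℝ :=
  fun g => lineDeriv ℝ F g (Pi.single e 1)

theorem pd_const (e : E) (a : ℝ) : pd e (fun _ : E → ℝ => a) = fun _ => 0 := by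
  funext g; simp [pd, lineDeriv]

variable [Fintype E]

theorem _root_.Function.HasTemperateGrowth.differentiable {V W : Type*} [NormedAddCommGroup V]
    [NormedSpace ℝ V] [NormedAddCommGroup W] [NormedSpace ℝ W] {F : V → W}
    (hF : F.HasTemperateGrowth) : Differentiable ℝ F :=
  hF.1.differentiable (by simp)

theorem _root_.Function.HasTemperateGrowth.fderiv {V W : Type*} [NormedAddCommGroup V]
    [NormedSpace ℝ V] [NormedAddCommGroup W] [NormedSpace ℝ W] {F : V → W}
    (hF : F.HasTemperateGrowth) : (fderiv ℝ F).HasTemperateGrowth := by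
  refine ⟨hF.1.fderiv_right (by simp), fun n => ?_⟩
  obtain ⟨k, C, h⟩ := hF.2 (n + 1)
  exact ⟨k, C, fun x => by rw [norm_iteratedFDeriv_fderiv]; exact h x⟩

theorem pd_eq_fderiv {F : (E → ℝ) → ℝ} (hF : F.HasTemperateGrowth) (e : E) :
    pd e F = fun g => fderiv ℝ F g (Pi.single e 1) := by
  funext g
  exact (hF.differentiable g).lineDeriv_eq_fderiv

@[fun_prop]
theorem temperate_pd {F : (E → ℝ) → ℝ} (hF : F.HasTemperateGrowth) (e : E) :
    (pd e F).HasTemperateGrowth := by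
  rw [pd_eq_fderiv hF]
  exact ((ContinuousLinearMap.apply ℝ ℝ (Pi.single e (1 : ℝ) : E → ℝ)).hasTemperateGrowth).comp
    hF.fderiv

variable {F G : (E → ℝ) → ℝ}

theorem pd_add (hF : F.HasTemperateGrowth) (hG : G.HasTemperateGrowth) (e : E) :
    pd e (fun g => F g + G g) = fun g => pd e F g + pd e G g := by
  rw [pd_eq_fderiv (by fun_prop), pd_eq_fderiv hF, pd_eq_fderiv hG]
  funext g
  rw [fderiv_fun_add (hF.differentiable g) (hG.differentiable g)]
  rfl

theorem pd_mul (hF : F.HasTemperateGrowth) (hG : G.HasTemperateGrowth) (e : E) :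
    pd e (fun g => F g * G g) = fun g => pd e F g * G g + F g * pd e G g := by
  rw [pd_eq_fderiv (by fun_prop), pd_eq_fderiv hF, pd_eq_fderiv hG]
  funext g
  rw [fderiv_fun_mul (hF.differentiable g) (hG.differentiable g)]
  simp [mul_comm]; ring

theorem pd_const_mul (hF : F.HasTemperateGrowth) (a : ℝ) (e : E) :
    pd e (fun g => a * F g) = fun g => a * pd e F g := by
  rw [pd_mul (by fun_prop) hF, pd_const]; simp

theorem pd_sum {κ : Type*} (s : Finset κ) {f : κ → (E → ℝ) → ℝ}
    (hf : ∀ k, (f k).HasTemperateGrowth) (e : E) :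
    pd e (fun g => ∑ k ∈ s, f k g) = fun g => ∑ k ∈ s, pd e (f k) g := by
  rw [pd_eq_fderiv (by fun_prop)]
  funext g
  rw [fderiv_fun_sum fun k _ => (hf k).differentiable g, sum_apply]
  exact Finset.sum_congr rfl fun k _ => (congrFun (pd_eq_fderiv (hf k) e) g).symm

theorem pd_eval (e f : E) : pd e (fun g : E → ℝ => g f) = fun _ => if f = e then 1 else 0 := by
  rw [pd_eq_fderiv (by fun_prop)]
  funext g
  have : fderiv ℝ (fun g : E → ℝ => g f) g = ContinuousLinearMap.proj f :=
    (ContinuousLinearMap.proj (R := ℝ) (φ := fun _ : E => ℝ) f).fderiv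
  rw [this]
  simp [Pi.single_apply]

theorem pd_comm (hF : F.HasTemperateGrowth) (e f : E) : pd e (pd f F) = pd f (pd e F) := by
  have key : ∀ (a b : E) (g : E → ℝ),
      pd a (pd b F) g = fderiv ℝ (fderiv ℝ F) g (Pi.single a 1) (Pi.single b 1) := by
    intro a b g
    rw [pd_eq_fderiv (temperate_pd hF b), pd_eq_fderiv hF]
    have h := ((hF.fderiv.differentiable g).hasFDerivAt.clm_apply
      (hasFDerivAt_const (Pi.single b (1 : ℝ) : E → ℝ) g)).fderiv
    simp only
    rw [h]
    simp
  funext g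
  rw [key, key]
  exact (hF.1.contDiffAt.isSymmSndFDerivAt (by simp; norm_cast)).eq _ _

theorem pd_comp {φ φ' : ℝ → ℝ} (hφ : ∀ x, HasDerivAt φ (φ' x) x) (hF : F.HasTemperateGrowth)
    (e : E) : pd e (fun g => φ (F g)) = fun g => φ' (F g) * pd e F g := by
  funext g
  have h := ((hφ (F g)).comp_hasFDerivAt g (hF.differentiable g).hasFDerivAt)
  rw [pd_eq_fderiv hF]
  have := (h.hasLineDerivAt (Pi.single e 1)).lineDeriv
  simpa [pd, Function.comp_def] using this

end Derivatives

/-! ### Gaussian integration by parts. -/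

section IntegrationByParts

theorem integral_id_mul_gaussianReal {f f' : ℝ → ℝ} (hf : ∀ x, HasDerivAt f (f' x) x)
    (h₀ : Integrable f (gaussianReal 0 1)) (h₁ : Integrable (fun x => x * f x) (gaussianReal 0 1))
    (h₂ : Integrable f' (gaussianReal 0 1)) :
    ∫ x, x * f x ∂gaussianReal 0 1 = ∫ x, f' x ∂gaussianReal 0 1 := by
  have hI : ∀ {u : ℝ → ℝ}, Integrable u (gaussianReal 0 1) →
      Integrable (fun x => u x * gaussianPDFReal 0 1 x) := by
    intro u hu
    rw [gaussianReal_of_var_ne_zero 0 one_ne_zero,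
      integrable_withDensity_iff (measurable_gaussianPDF 0 1)
        (ae_of_all _ fun x => gaussianPDF_lt_top)] at hu
    simpa [toReal_gaussianPDF] using hu
  have hφ : ∀ x, HasDerivAt (gaussianPDFReal 0 1) (-x * gaussianPDFReal 0 1 x) x := by
    intro x
    have h : HasDerivAt (fun x : ℝ => -(x - 0) ^ 2 / (2 * ((1 : NNReal) : ℝ))) (-x) x := by
      have := (((hasDerivAt_id x).sub_const 0).pow 2).neg.div_const (2 * ((1 : NNReal) : ℝ))
      convert! this using 1
      simp only [id, NNReal.coe_one]
      ring
    have h2 := (h.exp).const_mul (√(2 * Real.pi * ((1 : NNReal) : ℝ)))⁻¹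
    unfold gaussianPDFReal
    convert! h2 using 1
    ring
  rw [integral_gaussianReal_eq_integral_smul one_ne_zero,
    integral_gaussianReal_eq_integral_smul one_ne_zero]
  have key := integral_mul_deriv_eq_deriv_mul_of_integrable (u := f) (u' := f')
    (v := gaussianPDFReal 0 1) (v' := fun x => -x * gaussianPDFReal 0 1 x)
    (fun x _ => hf x) (fun x _ => hφ x) ?_ (hI h₂) (hI h₀)
  · simp only [smul_eq_mul]
    have e1 : ∀ x, gaussianPDFReal 0 1 x * (x * f x) = -(f x * (-x * gaussianPDFReal 0 1 x)) :=
      fun x => by ring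
    have e2 : ∀ x, gaussianPDFReal 0 1 x * f' x = f' x * gaussianPDFReal 0 1 x :=
      fun x => by ring
    simp_rw [e1, e2, integral_neg, key, neg_neg]
  · have := (hI h₁).neg
    refine this.congr (ae_of_all _ fun x => ?_)
    simp; ring

variable {E : Type*} [Fintype E] [DecidableEq E]

/-- Resampling one coordinate does not change the law; this isolates a single coordinate, so that
Fubini reduces integration by parts to dimension one. -/
theorem measurePreserving_update (e : E) :
    MeasurePreserving (fun z : (E → ℝ) × ℝ => Function.update z.1 e z.2)
      ((stdMeasure E).prod (gaussianReal 0 1)) (stdMeasure E) := by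
  have hm : Measurable (fun z : (E → ℝ) × ℝ => Function.update z.1 e z.2) := by
    refine measurable_pi_lambda _ fun i => ?_
    by_cases h : i = e
    · subst h; simpa using measurable_snd
    · simp only [Function.update_of_ne h]
      exact (measurable_pi_apply i).comp measurable_fst
  refine ⟨hm, ?_⟩
  refine (Measure.pi_eq fun s hs => ?_).symm
  rw [Measure.map_apply hm (MeasurableSet.univ_pi hs)]
  have : (fun z : (E → ℝ) × ℝ => Function.update z.1 e z.2) ⁻¹' Set.univ.pi s =
      (Set.univ.pi (Function.update s e Set.univ)) ×ˢ s e := by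
    ext ⟨x, t⟩
    simp only [Set.mem_preimage, Set.mem_pi, Set.mem_univ, true_implies, Set.mem_prod]
    constructor
    · intro h
      refine ⟨fun i => ?_, by simpa using h e⟩
      by_cases hi : i = e
      · subst hi; simp
      · simpa [hi] using h i
    · rintro ⟨h, h'⟩ i
      by_cases hi : i = e
      · subst hi; simpa using h'
      · simpa [hi] using h i
  rw [this, Measure.prod_prod, stdMeasure, Measure.pi_pi,
    ← Finset.mul_prod_erase _ _ (Finset.mem_univ e), ← Finset.mul_prod_erase _ _ (Finset.mem_univ e)]
  simp only [Function.update_self, measure_univ, one_mul]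
  rw [mul_comm]
  congr 1
  refine Finset.prod_congr rfl fun i hi => ?_
  rw [Function.update_of_ne (Finset.ne_of_mem_erase hi)]

theorem integral_eval_mul {F : (E → ℝ) → ℝ} (hF : F.HasTemperateGrowth) (e : E) :
    ∫ g, g e * F g ∂stdMeasure E = ∫ g, pd e F g ∂stdMeasure E := by
  have hmp := measurePreserving_update (E := E) e
  have hint : ∀ {H : (E → ℝ) → ℝ}, H.HasTemperateGrowth →
      Integrable (fun z : (E → ℝ) × ℝ => H (Function.update z.1 e z.2))
        ((stdMeasure E).prod (gaussianReal 0 1)) :=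
    fun hH => hmp.integrable_comp_of_integrable (integrable_of_temperate hH)
  have htrans : ∀ {H : (E → ℝ) → ℝ}, H.HasTemperateGrowth →
      ∫ g, H g ∂stdMeasure E =
        ∫ x, ∫ t, H (Function.update x e t) ∂gaussianReal 0 1 ∂stdMeasure E := by
    intro H hH
    rw [← integral_prod _ (hint hH), ← hmp.map_eq, integral_map hmp.measurable.aemeasurable]
    · rw [hmp.map_eq]
    · exact hH.1.continuous.aestronglyMeasurable
  have hgF : (fun g : E → ℝ => g e * F g).HasTemperateGrowth := by fun_prop
  have hpF := temperate_pd hF e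
  rw [htrans hgF, htrans hpF]
  refine integral_congr_ae ?_
  filter_upwards [(hint hF).prod_right_ae, (hint hgF).prod_right_ae, (hint hpF).prod_right_ae]
    with x h1 h2 h3
  simp only [Function.update_self] at h2 ⊢
  refine integral_id_mul_gaussianReal (fun t => ?_) h1 h2 h3
  have := (hF.differentiable (Function.update x e t)).hasFDerivAt.comp_hasDerivAt t
    (hasDerivAt_update x e t)
  rw [pd_eq_fderiv hF]
  exact this

end IntegrationByParts

end GaussSpace

namespace GaussSpace

open scoped ENNReal

/-! ### Norms of `L^q` with dyadic exponents. -/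

section Norms

variable {E : Type*} [Fintype E]

/-- The norm of `L^q` of the standard Gaussian measure for the exponent `q = 2 ^ s`. -/
noncomputable def nrm (s : ℕ) (F : (E → ℝ) → ℝ) : ℝ := lpNorm F (2 ^ s) (stdMeasure E)

variable {F G : (E → ℝ) → ℝ}

theorem two_pow_ne_top (s : ℕ) : (2 : ℝ≥0∞) ^ s ≠ ∞ := ENNReal.pow_ne_top (by simp)

theorem one_le_two_pow_ennreal (s : ℕ) : (1 : ℝ≥0∞) ≤ 2 ^ s := one_le_pow₀ (by norm_num)

theorem nrm_nonneg (s : ℕ) (F : (E → ℝ) → ℝ) : 0 ≤ nrm s F := lpNorm_nonneg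

theorem nrm_add_le (hF : F.HasTemperateGrowth) (s : ℕ) :
    nrm s (fun g => F g + G g) ≤ nrm s F + nrm s G :=
  lpNorm_add_le (memLp_of_temperate hF (two_pow_ne_top s)) (one_le_two_pow_ennreal s)

theorem nrm_sum_le {κ : Type*} (A : Finset κ) {f : κ → (E → ℝ) → ℝ}
    (hf : ∀ k, (f k).HasTemperateGrowth) (s : ℕ) :
    nrm s (fun g => ∑ k ∈ A, f k g) ≤ ∑ k ∈ A, nrm s (f k) := by
  have := lpNorm_sum_le (s := A) (fun k _ => memLp_of_temperate (hf k) (two_pow_ne_top s))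
    (one_le_two_pow_ennreal s)
  have h : (fun g => ∑ k ∈ A, f k g) = ∑ k ∈ A, f k := by funext g; simp
  unfold nrm
  rwa [h]

theorem nrm_const_mul (a : ℝ) (F : (E → ℝ) → ℝ) (s : ℕ) :
    nrm s (fun g => a * F g) = |a| * nrm s F := by
  have := lpNorm_const_smul (p := 2 ^ s) a F (stdMeasure E)
  simpa [nrm] using! this

theorem nrm_zero (s : ℕ) : nrm s (fun _ : E → ℝ => 0) = 0 := lpNorm_fun_zero _ _

/-- Hölder with both exponents doubled, which for dyadic exponents is a shift of `s` by one. -/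
theorem nrm_mul_le (hF : F.HasTemperateGrowth) (hG : G.HasTemperateGrowth) (s : ℕ) :
    nrm s (fun g => F g * G g) ≤ nrm (s + 1) F * nrm (s + 1) G := by
  have hT : ENNReal.HolderTriple (2 ^ (s + 1)) (2 ^ (s + 1)) (2 ^ s) := by
    rw [pow_succ']; exact holderTriple_two_mul _
  have h1 := memLp_of_temperate hF (two_pow_ne_top (s + 1))
  have h2 := memLp_of_temperate hG (two_pow_ne_top (s + 1))
  have h := eLpNorm_smul_le_mul_eLpNorm (p := 2 ^ (s + 1)) (q := 2 ^ (s + 1))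
    (r := 2 ^ s) h2.1 h1.1
  have h3 := memLp_of_temperate (hF.mul hG) (two_pow_ne_top s)
  unfold nrm
  rw [← toReal_eLpNorm h1.1, ← toReal_eLpNorm h2.1, ← ENNReal.toReal_mul]
  change lpNorm (F * G) _ _ ≤ _
  rw [← toReal_eLpNorm h3.1]
  exact ENNReal.toReal_mono (ENNReal.mul_ne_top h1.2.ne h2.2.ne) h

theorem nrm_mono (hF : F.HasTemperateGrowth) {s s' : ℕ} (h : s ≤ s') : nrm s F ≤ nrm s' F := by
  have h1 := memLp_of_temperate hF (two_pow_ne_top s')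
  unfold nrm
  rw [← toReal_eLpNorm h1.1, ← toReal_eLpNorm h1.1]
  exact ENNReal.toReal_mono h1.2.ne
    (eLpNorm_le_eLpNorm_of_exponent_le (pow_le_pow_right₀ (by norm_num) h) h1.1)

theorem nrm_const (a : ℝ) (s : ℕ) : nrm s (fun _ : E → ℝ => a) = |a| := by
  unfold nrm
  rw [lpNorm_const (by positivity) (NeZero.ne _)]
  simp

theorem nrm_le_of_abs_le {a : ℝ} (h : ∀ g, |F g| ≤ a) (s : ℕ) :
    nrm s F ≤ a := by
  have ha : 0 ≤ a := (abs_nonneg _).trans (h 0)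
  calc nrm s F ≤ nrm s (fun _ : E → ℝ => a) :=
        lpNorm_mono_real (memLp_const a) h
    _ = a := by rw [nrm_const, abs_of_nonneg ha]

theorem nrm_pow (hF : F.HasTemperateGrowth) (s : ℕ) :
    nrm s F ^ 2 ^ s = ∫ g, |F g| ^ 2 ^ s ∂stdMeasure E := by
  unfold nrm
  rw [lpNorm_eq_integral_norm_rpow_toReal (by positivity) (two_pow_ne_top s)
    hF.1.continuous.aestronglyMeasurable]
  have h2 : ((2 : ℝ≥0∞) ^ s).toReal = ((2 ^ s : ℕ) : ℝ) := by simp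
  rw [h2, Real.rpow_inv_natCast_pow (integral_nonneg fun g => by positivity) (by positivity)]
  simp_rw [Real.rpow_natCast, Real.norm_eq_abs]

theorem nrm_sum_mul_le {κ : Type*} [Fintype κ] {f h : κ → (E → ℝ) → ℝ}
    (hf : ∀ k, (f k).HasTemperateGrowth) (hh : ∀ k, (h k).HasTemperateGrowth) (s : ℕ) :
    nrm s (fun g => ∑ k, f k g * h k g) ^ 2 ≤
      (∑ k, nrm (s + 1) (f k) ^ 2) * ∑ k, nrm (s + 1) (h k) ^ 2 := by
  have h1 : nrm s (fun g => ∑ k, f k g * h k g) ≤ ∑ k, nrm (s + 1) (f k) * nrm (s + 1) (h k) :=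
    (nrm_sum_le _ (fun k => (hf k).mul (hh k)) s).trans
      (Finset.sum_le_sum fun k _ => nrm_mul_le (hf k) (hh k) s)
  exact (pow_le_pow_left₀ (nrm_nonneg _ _) h1 2).trans (Finset.sum_mul_sq_le_sq_mul_sq _ _ _)

end Norms

/-! ### Dimension-free moment bounds for the Gaussian divergence. -/

section Divergence

variable {E ι : Type*} [Fintype E] [DecidableEq E] [Fintype ι]

/-- The Gaussian divergence of a vector field with components in the directions `e i`. -/
noncomputable def gaussDiv (e : ι → E) (u : ι → (E → ℝ) → ℝ) : (E → ℝ) → ℝ :=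
  fun g => ∑ i, (g (e i) * u i g - pd (e i) (u i) g)

/-- A squared Sobolev norm of order `r`, with derivatives in the directions `e i` only. -/
noncomputable def sob (e : ι → E) (s : ℕ) : ℕ → ((E → ℝ) → ℝ) → ℝ
  | 0, F => nrm s F ^ 2
  | r + 1, F => nrm s F ^ 2 + ∑ l, sob e s r (pd (e l) F)

variable {e : ι → E} {s : ℕ}

theorem sob_nonneg (r : ℕ) (F : (E → ℝ) → ℝ) : 0 ≤ sob e s r F := by
  induction r generalizing F with
  | zero => exact sq_nonneg _
  | succ r ih => exact add_nonneg (sq_nonneg _) (Finset.sum_nonneg fun l _ => ih _)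

theorem nrm_sq_le_sob (r : ℕ) (F : (E → ℝ) → ℝ) : nrm s F ^ 2 ≤ sob e s r F := by
  cases r with
  | zero => exact le_rfl
  | succ r => exact le_add_of_nonneg_right (Finset.sum_nonneg fun l _ => sob_nonneg _ _)

theorem sob_le_succ (r : ℕ) (F : (E → ℝ) → ℝ) : sob e s r F ≤ sob e s (r + 1) F := by
  induction r generalizing F with
  | zero => exact nrm_sq_le_sob 1 F
  | succ r ih => exact add_le_add le_rfl (Finset.sum_le_sum fun l _ => ih _)

theorem sob_mono {r r' : ℕ} (h : r ≤ r') (F : (E → ℝ) → ℝ) : sob e s r F ≤ sob e s r' F :=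
  monotone_nat_of_le_succ (f := fun r => sob e s r F) (fun r => sob_le_succ r F) h

theorem sum_sob_pd_le (r : ℕ) (F : (E → ℝ) → ℝ) :
    ∑ l, sob e s r (pd (e l) F) ≤ sob e s (r + 1) F :=
  le_add_of_nonneg_left (sq_nonneg _)

theorem sob_add_le {F G : (E → ℝ) → ℝ} (hF : F.HasTemperateGrowth) (hG : G.HasTemperateGrowth)
    (r : ℕ) : sob e s r (fun g => F g + G g) ≤ 2 * sob e s r F + 2 * sob e s r G := by
  have h0 : ∀ {F G : (E → ℝ) → ℝ}, F.HasTemperateGrowth →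
      nrm s (fun g => F g + G g) ^ 2 ≤ 2 * nrm s F ^ 2 + 2 * nrm s G ^ 2 := by
    intro F G hF
    have h1 := nrm_add_le (G := G) hF s
    nlinarith [nrm_nonneg s (fun g => F g + G g), sq_nonneg (nrm s F - nrm s G),
      nrm_nonneg s F, nrm_nonneg s G]
  induction r generalizing F G with
  | zero => exact h0 hF
  | succ r ih =>
    have h2 : ∑ l, sob e s r (pd (e l) fun g => F g + G g) ≤
        ∑ l, (2 * sob e s r (pd (e l) F) + 2 * sob e s r (pd (e l) G)) :=
      Finset.sum_le_sum fun l _ => by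
        rw [pd_add hF hG]
        exact ih (temperate_pd hF _) (temperate_pd hG _)
    rw [Finset.sum_add_distrib, ← Finset.mul_sum, ← Finset.mul_sum] at h2
    have h1 := h0 (G := G) hF
    simp only [sob]
    linarith

/-- Leibniz together with Cauchy–Schwarz in `k`; the constant does not see the number of summands or
of directions. -/
theorem sob_sum_mul_le {κ : Type*} [Fintype κ] {f h : κ → (E → ℝ) → ℝ}
    (hf : ∀ k, (f k).HasTemperateGrowth) (hh : ∀ k, (h k).HasTemperateGrowth) (r : ℕ) :
    sob e s r (fun g => ∑ k, f k g * h k g) ≤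
      5 ^ r * ((∑ k, sob e (s + 1) r (f k)) * ∑ k, sob e (s + 1) r (h k)) := by
  induction r generalizing f h with
  | zero => simpa [sob] using nrm_sum_mul_le hf hh s
  | succ r ih =>
    set A := ∑ k, sob e (s + 1) (r + 1) (f k) with hA
    set B := ∑ k, sob e (s + 1) (r + 1) (h k) with hB
    have hA0 : 0 ≤ A := Finset.sum_nonneg fun _ _ => sob_nonneg _ _
    have hB0 : 0 ≤ B := Finset.sum_nonneg fun _ _ => sob_nonneg _ _
    have h1 : nrm s (fun g => ∑ k, f k g * h k g) ^ 2 ≤ A * B :=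
      (nrm_sum_mul_le hf hh s).trans <| mul_le_mul
        (Finset.sum_le_sum fun _ _ => nrm_sq_le_sob _ _)
        (Finset.sum_le_sum fun _ _ => nrm_sq_le_sob _ _)
        (Finset.sum_nonneg fun _ _ => sq_nonneg _) hA0
    have hstep : ∀ l, sob e s r (pd (e l) fun g => ∑ k, f k g * h k g) ≤
        2 * (5 ^ r * ((∑ k, sob e (s + 1) r (pd (e l) (f k))) * B)) +
        2 * (5 ^ r * (A * ∑ k, sob e (s + 1) r (pd (e l) (h k)))) := by
      intro l
      have e1 : (pd (e l) fun g => ∑ k, f k g * h k g) =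
          fun g => (∑ k, pd (e l) (f k) g * h k g) + ∑ k, f k g * pd (e l) (h k) g := by
        rw [pd_sum _ (f := fun k g => f k g * h k g) (fun k => (hf k).mul (hh k))]
        funext g
        rw [← Finset.sum_add_distrib]
        exact Finset.sum_congr rfl fun k _ => congrFun (pd_mul (hf k) (hh k) (e l)) g
      rw [e1]
      refine (sob_add_le (by fun_prop) (by fun_prop) r).trans ?_
      refine add_le_add ?_ ?_
      · gcongr
        refine (ih (fun k => temperate_pd (hf k) _) hh).trans ?_
        gcongr
        · exact Finset.sum_nonneg fun _ _ => sob_nonneg _ _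
        · exact Finset.sum_le_sum fun _ _ => sob_le_succ _ _
      · gcongr
        refine (ih hf (fun k => temperate_pd (hh k) _)).trans ?_
        gcongr
        · exact Finset.sum_nonneg fun _ _ => sob_nonneg _ _
        · exact Finset.sum_le_sum fun _ _ => sob_le_succ _ _
    have hcomm : ∀ f : κ → (E → ℝ) → ℝ, ∑ l, ∑ k, sob e (s + 1) r (pd (e l) (f k)) ≤
        ∑ k, sob e (s + 1) (r + 1) (f k) := by
      intro f
      rw [Finset.sum_comm]
      exact Finset.sum_le_sum fun k _ => sum_sob_pd_le _ _
    have h2 : ∑ l, sob e s r (pd (e l) fun g => ∑ k, f k g * h k g) ≤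
        2 * (5 ^ r * (A * B)) + 2 * (5 ^ r * (A * B)) := by
      refine (Finset.sum_le_sum fun l _ => hstep l).trans ?_
      rw [Finset.sum_add_distrib]
      simp_rw [← Finset.mul_sum, ← Finset.sum_mul]
      gcongr
      · exact hcomm f
      · exact hcomm h
    -- The undifferentiated term and the two Leibniz halves, each doubled by `sob_add_le`, add up to
    -- `1 + 4 * 5 ^ r ≤ 5 ^ (r + 1)`.
    have h5 : (1 : ℝ) ≤ 5 ^ r := one_le_pow₀ (by norm_num)
    have hAB : 0 ≤ A * B := mul_nonneg hA0 hB0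
    simp only [sob]
    rw [pow_succ (5 : ℝ)]
    nlinarith [mul_le_mul_of_nonneg_right h5 hAB]

@[fun_prop]
theorem temperate_gaussDiv {u : ι → (E → ℝ) → ℝ} (hu : ∀ i, (u i).HasTemperateGrowth) :
    (gaussDiv e u).HasTemperateGrowth := by
  unfold gaussDiv; fun_prop

theorem integral_gaussDiv_mul {u : ι → (E → ℝ) → ℝ} (hu : ∀ i, (u i).HasTemperateGrowth)
    {H : (E → ℝ) → ℝ} (hH : H.HasTemperateGrowth) :
    ∫ g, gaussDiv e u g * H g ∂stdMeasure E = ∫ g, ∑ i, u i g * pd (e i) H g ∂stdMeasure E := by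
  have h1 : ∀ i, ∫ g, (g (e i) * (u i g * H g) - pd (e i) (u i) g * H g) ∂stdMeasure E =
      ∫ g, u i g * pd (e i) H g ∂stdMeasure E := by
    intro i
    have hi := hu i
    rw [integral_sub (integrable_of_temperate (by fun_prop)) (integrable_of_temperate (by fun_prop)),
      integral_eval_mul (F := fun g => u i g * H g) (by fun_prop), pd_mul hi hH,
      integral_add (integrable_of_temperate (by fun_prop)) (integrable_of_temperate (by fun_prop))]
    ring
  rw [integral_finsetSum _ fun i _ => integrable_of_temperate (by have := hu i; fun_prop)]
  simp_rw [← h1]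
  rw [← integral_finsetSum _ fun i _ => integrable_of_temperate (by have := hu i; fun_prop)]
  congr 1
  funext g
  rw [gaussDiv, Finset.sum_mul]
  exact Finset.sum_congr rfl fun i _ => by ring

/-- The vector field `∑ i, u i * ∂ i u`. -/
noncomputable def selfTransport (e : ι → E) (u : ι → (E → ℝ) → ℝ) : ι → (E → ℝ) → ℝ :=
  fun j g => ∑ i, u i g * pd (e i) (u j) g

@[fun_prop]
theorem temperate_selfTransport {u : ι → (E → ℝ) → ℝ} (hu : ∀ i, (u i).HasTemperateGrowth)
    (j : ι) : (selfTransport e u j).HasTemperateGrowth := by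
  unfold selfTransport; fun_prop

/-- The commutation relation `∂_i δ(u) = u_i + δ(∂_i u)`, contracted with `u`; pulling `u_i` inside
the divergence produces the trace of `(Du)²`. -/
theorem sum_mul_pd_gaussDiv (he : Function.Injective e) {u : ι → (E → ℝ) → ℝ}
    (hu : ∀ i, (u i).HasTemperateGrowth) (g : E → ℝ) :
    ∑ i, u i g * pd (e i) (gaussDiv e u) g =
      (∑ i, u i g * u i g + ∑ i, ∑ j, pd (e j) (u i) g * pd (e i) (u j) g) +
        gaussDiv e (selfTransport e u) g := by
  classical
  have h1 : ∀ i, pd (e i) (gaussDiv e u) g = u i g +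
      ∑ j, (g (e j) * pd (e i) (u j) g - pd (e i) (pd (e j) (u j)) g) := by
    intro i
    have hj : ∀ j, pd (e i) (fun g => g (e j) * u j g + (-1) * pd (e j) (u j) g) =
        fun g => ((if e j = e i then 1 else 0) * u j g + g (e j) * pd (e i) (u j) g) +
          (-1) * pd (e i) (pd (e j) (u j)) g := by
      intro j
      have := hu j
      rw [pd_add (by fun_prop) (by fun_prop), pd_mul (by fun_prop) (by fun_prop), pd_eval,
        pd_const_mul (by fun_prop)]
    have hd : gaussDiv e u = fun g => ∑ j, (g (e j) * u j g + (-1) * pd (e j) (u j) g) := by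
      funext g
      exact Finset.sum_congr rfl fun j _ => by ring
    rw [hd, pd_sum _ (fun j => by have := hu j; fun_prop)]
    simp only [hj]
    have h2 : u i g = ∑ j, (if e j = e i then 1 else 0) * u j g := by
      simp [he.eq_iff]
    rw [h2, ← Finset.sum_add_distrib]
    exact Finset.sum_congr rfl fun j _ => by ring
  have h3 : ∀ j, pd (e j) (selfTransport e u j) g =
      ∑ i, (pd (e j) (u i) g * pd (e i) (u j) g + u i g * pd (e i) (pd (e j) (u j)) g) := by
    intro j
    unfold selfTransport
    rw [pd_sum _ (fun i => by have := hu i; have := hu j; fun_prop)]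
    refine Finset.sum_congr rfl fun i _ => ?_
    rw [pd_mul (hu i) (temperate_pd (hu j) _), pd_comm (hu j)]
  simp_rw [h1, mul_add, Finset.sum_add_distrib, gaussDiv, h3, selfTransport]
  rw [add_assoc]
  congr 1
  rw [Finset.sum_comm (f := fun i j => pd (e j) (u i) g * pd (e i) (u j) g),
    ← Finset.sum_add_distrib]
  simp_rw [Finset.mul_sum]
  rw [Finset.sum_comm]
  refine Finset.sum_congr rfl fun j _ => ?_
  rw [← Finset.sum_sub_distrib, ← Finset.sum_add_distrib]
  exact Finset.sum_congr rfl fun i _ => by ring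

theorem nrm_field_terms_le {u : ι → (E → ℝ) → ℝ} (hu : ∀ i, (u i).HasTemperateGrowth) (s : ℕ) :
    nrm s (fun g => ∑ i, u i g * u i g + ∑ i, ∑ j, pd (e j) (u i) g * pd (e i) (u j) g) ≤
      ∑ i, sob e (s + 1) 1 (u i) := by
  refine (nrm_add_le (by fun_prop) s).trans ?_
  simp only [sob, Finset.sum_add_distrib]
  refine add_le_add ?_ ?_
  · refine (nrm_sum_le _ (fun i => (hu i).mul (hu i)) s).trans (Finset.sum_le_sum fun i _ => ?_)
    exact (nrm_mul_le (hu i) (hu i) s).trans_eq (sq _).symm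
  · have h1 : nrm s (fun g => ∑ i, ∑ j, pd (e j) (u i) g * pd (e i) (u j) g) ≤
        ∑ i, ∑ j, nrm (s + 1) (pd (e j) (u i)) * nrm (s + 1) (pd (e i) (u j)) := by
      refine (nrm_sum_le _ (fun i => by fun_prop) s).trans (Finset.sum_le_sum fun i _ => ?_)
      refine (nrm_sum_le _ (fun j => by fun_prop) s).trans (Finset.sum_le_sum fun j _ => ?_)
      exact nrm_mul_le (by fun_prop) (by fun_prop) s
    -- By `ab ≤ a²/2 + b²/2` the trace is dominated by the Hilbert–Schmidt norm, since the two
    -- halves agree after exchanging `i` and `j`.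
    have h2 : ∑ i, ∑ j, nrm (s + 1) (pd (e j) (u i)) * nrm (s + 1) (pd (e i) (u j)) ≤
        ∑ i, ∑ j, (nrm (s + 1) (pd (e j) (u i)) ^ 2 / 2 + nrm (s + 1) (pd (e i) (u j)) ^ 2 / 2) :=
      Finset.sum_le_sum fun i _ => Finset.sum_le_sum fun j _ => by
        nlinarith [sq_nonneg (nrm (s + 1) (pd (e j) (u i)) - nrm (s + 1) (pd (e i) (u j)))]
    refine (h1.trans h2).trans_eq ?_
    simp_rw [Finset.sum_add_distrib]
    rw [Finset.sum_comm (f := fun i j => nrm (s + 1) (pd (e i) (u j)) ^ 2 / 2),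
      ← Finset.sum_add_distrib]
    refine Finset.sum_congr rfl fun i _ => ?_
    rw [← Finset.sum_add_distrib]
    exact Finset.sum_congr rfl fun i _ => by ring

theorem sum_sob_selfTransport_le {u : ι → (E → ℝ) → ℝ} (hu : ∀ i, (u i).HasTemperateGrowth)
    (s r : ℕ) : ∑ j, sob e s r (selfTransport e u j) ≤
      5 ^ r * (∑ i, sob e (s + 1) (r + 1) (u i)) ^ 2 := by
  set A := ∑ i, sob e (s + 1) (r + 1) (u i)
  have hA : ∑ i, sob e (s + 1) r (u i) ≤ A := Finset.sum_le_sum fun _ _ => sob_le_succ _ _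
  have h1 : ∀ j, sob e s r (selfTransport e u j) ≤
      5 ^ r * (A * ∑ i, sob e (s + 1) r (pd (e i) (u j))) := by
    intro j
    refine (sob_sum_mul_le hu (fun i => temperate_pd (hu j) _) r).trans ?_
    gcongr
    exact Finset.sum_nonneg fun _ _ => sob_nonneg _ _
  refine (Finset.sum_le_sum fun j _ => h1 j).trans ?_
  rw [← Finset.mul_sum, ← Finset.mul_sum, sq]
  have hA0 : 0 ≤ A := Finset.sum_nonneg fun _ _ => sob_nonneg _ _
  gcongr
  exact Finset.sum_le_sum fun j _ => sum_sob_pd_le _ _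

/-- The cases split at `a = 2cb`. The coefficient `1/2` allows the moment of the divergence to be
absorbed into the left side. -/
theorem moment_young {n : ℕ} {a b c : ℝ} (ha : 0 ≤ a) (hb : 0 ≤ b) (hc : 0 ≤ c) :
    c * (a ^ n * b) ≤ a ^ (n + 1) / 2 + c * (2 * c) ^ n * b ^ (n + 1) := by
  rcases le_total (2 * c * b) a with h | h
  · have h1 : c * (a ^ n * b) ≤ a ^ (n + 1) / 2 := by
      rw [pow_succ]
      nlinarith [mul_le_mul_of_nonneg_left h (pow_nonneg ha n)]
    have : 0 ≤ c * (2 * c) ^ n * b ^ (n + 1) := by positivity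
    linarith
  · have h1 : c * (a ^ n * b) ≤ c * ((2 * c * b) ^ n * b) := by gcongr
    have : 0 ≤ a ^ (n + 1) / 2 := by positivity
    have h2 : c * ((2 * c * b) ^ n * b) = c * (2 * c) ^ n * b ^ (n + 1) := by
      rw [mul_pow, pow_succ]; ring
    linarith

/-- Integration by parts against `δ(u) ^ (2n + 1)`, whose gradient brings down `u·∇δ(u)`. -/
theorem integral_gaussDiv_pow (he : Function.Injective e) {u : ι → (E → ℝ) → ℝ}
    (hu : ∀ i, (u i).HasTemperateGrowth) (n : ℕ) :
    ∫ g, gaussDiv e u g ^ (2 * n + 2) ∂stdMeasure E = ∫ g, (2 * n + 1) *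
      (gaussDiv e u g ^ (2 * n) *
        ((∑ i, u i g * u i g + ∑ i, ∑ j, pd (e j) (u i) g * pd (e i) (u j) g) +
          gaussDiv e (selfTransport e u) g)) ∂stdMeasure E := by
  have h := integral_gaussDiv_mul (e := e) hu
    (H := fun g => gaussDiv e u g ^ (2 * n + 1)) (by fun_prop)
  have h1 : ∀ g, gaussDiv e u g ^ (2 * n + 2) = gaussDiv e u g * gaussDiv e u g ^ (2 * n + 1) :=
    fun g => by ring
  simp_rw [h1, h]
  congr 1
  funext g
  rw [← sum_mul_pd_gaussDiv he hu, Finset.mul_sum, Finset.mul_sum]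
  refine Finset.sum_congr rfl fun i _ => ?_
  rw [pd_comp (φ := fun x => x ^ (2 * n + 1)) (fun x => hasDerivAt_pow (2 * n + 1) x)
    (by fun_prop)]
  simp
  ring

/-- A Sobolev bound of order `m` for a vector field bounds the moment of order `2 ^ m` of its
Gaussian divergence, for `m ≥ 1`. -/
theorem exists_nrm_gaussDiv_le (m : ℕ) (K : ℝ) : ∃ C : ℝ, 0 ≤ C ∧
    ∀ (E ι : Type) [Fintype E] [DecidableEq E] [Fintype ι] (e : ι → E) (u : ι → (E → ℝ) → ℝ),
      Function.Injective e → (∀ i, (u i).HasTemperateGrowth) →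
      ∑ i, sob e (m + 1) (m + 1) (u i) ≤ K → nrm (m + 1) (gaussDiv e u) ≤ C := by
  induction m generalizing K with
  | zero =>
    refine ⟨|K| + 1, by positivity, ?_⟩
    intro E ι _ _ _ e u he hu hK
    have h1 := nrm_pow (temperate_gaussDiv (e := e) hu) 1
    have h2 := integral_gaussDiv_pow he hu 0
    -- Divergences have mean zero, so the second moment needs no information on the transported
    -- field.
    have h3 : ∫ g, gaussDiv e (selfTransport e u) g ∂stdMeasure E = 0 := by
      have := integral_gaussDiv_mul (e := e) (u := selfTransport e u) (by fun_prop)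
        (H := fun _ => 1) (by fun_prop)
      simpa [pd_const] using this
    set Y := fun g => ∑ i, u i g * u i g + ∑ i, ∑ j, pd (e j) (u i) g * pd (e i) (u j) g with hY
    have hYt : Y.HasTemperateGrowth := by rw [hY]; fun_prop
    have h4 : ∫ g, Y g ∂stdMeasure E ≤ nrm 0 Y := by
      have := nrm_pow hYt 0
      simp only [pow_zero, pow_one] at this
      rw [this]
      exact integral_mono (integrable_of_temperate hYt) (integrable_of_temperate hYt).abs
        fun g => le_abs_self _
    have h5 : nrm 0 Y ≤ ∑ i, sob e 1 1 (u i) := nrm_field_terms_le hu 0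
    have h6 : nrm 1 (gaussDiv e u) ^ 2 ≤ K := by
      have h7 : ∫ g, gaussDiv e u g ^ 2 ∂stdMeasure E = ∫ g, Y g ∂stdMeasure E := by
        have : ∀ g, (2 * ((0 : ℕ) : ℝ) + 1) * (gaussDiv e u g ^ (2 * 0) * (Y g +
            gaussDiv e (selfTransport e u) g)) = Y g + gaussDiv e (selfTransport e u) g := by
          intro g; simp
        have h2' : ∫ g, gaussDiv e u g ^ 2 ∂stdMeasure E =
            ∫ g, (Y g + gaussDiv e (selfTransport e u) g) ∂stdMeasure E := by
          exact h2.trans (integral_congr_ae (ae_of_all _ this))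
        rw [h2', integral_add (integrable_of_temperate hYt)
          (integrable_of_temperate (by fun_prop)), h3, add_zero]
      simp only [pow_one, sq_abs] at h1
      rw [h1, h7]
      exact (h4.trans h5).trans hK
    rw [zero_add]
    nlinarith [nrm_nonneg 1 (gaussDiv e u), le_abs_self K, abs_nonneg K]
  | succ m ih =>
    -- This is the Sobolev bound for `u·∇u`, at the cost of one derivative and a doubled exponent
    -- (`sum_sob_selfTransport_le`).
    obtain ⟨C, hC0, hC⟩ := ih (5 ^ (m + 1) * K ^ 2)
    -- Chosen so that `2n + 2 = 2 ^ (m + 2)`; Young's inequality then leaves the power `n + 1 = 2 ^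
    -- (m + 1)`, the exponent supplied by the induction hypothesis.
    set n : ℕ := 2 ^ (m + 1) - 1 with hn
    have hn1 : n + 1 = 2 ^ (m + 1) := Nat.sub_add_cancel Nat.one_le_two_pow
    set c : ℝ := 2 * n + 1
    have hc0 : 0 ≤ c := by positivity
    -- The factor `2` undoes the absorption of half the moment.
    set B : ℝ := 2 * (c * (2 * c) ^ n * (|K| + C) ^ (n + 1)) with hB
    have hB0 : 0 ≤ B := by positivity
    refine ⟨B + 1, by positivity, ?_⟩
    intro E ι _ _ _ e u he hu hK
    have hK0 : 0 ≤ K := (Finset.sum_nonneg fun _ _ => sob_nonneg _ _).trans hK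
    have hv : nrm (m + 1) (gaussDiv e (selfTransport e u)) ≤ C := by
      refine hC E ι e _ he (by fun_prop) ((sum_sob_selfTransport_le hu _ _).trans ?_)
      gcongr
      exact Finset.sum_nonneg fun _ _ => sob_nonneg _ _
    set Y := fun g => (∑ i, u i g * u i g + ∑ i, ∑ j, pd (e j) (u i) g * pd (e i) (u j) g) +
      gaussDiv e (selfTransport e u) g with hY
    have hYt : Y.HasTemperateGrowth := by rw [hY]; fun_prop
    have hYn : nrm (m + 1) Y ≤ |K| + C := by
      refine (nrm_add_le (by fun_prop) _).trans (add_le_add ?_ hv)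
      refine (nrm_field_terms_le hu _).trans ((Finset.sum_le_sum fun i _ => ?_).trans
        (hK.trans (le_abs_self K)))
      exact sob_mono (by omega) _
    set X := gaussDiv e u with hX
    have hXt : X.HasTemperateGrowth := temperate_gaussDiv hu
    have h1 : nrm (m + 1 + 1) X ^ 2 ^ (m + 1 + 1) = ∫ g, X g ^ (2 * n + 2) ∂stdMeasure E := by
      have hexp : 2 ^ (m + 1 + 1) = 2 * n + 2 := by rw [pow_succ, ← hn1]; ring
      rw [nrm_pow hXt]
      congr 1
      funext g
      rw [hexp, show 2 * n + 2 = 2 * (n + 1) by ring, pow_mul, pow_mul, sq_abs]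
    have h2 := integral_gaussDiv_pow he hu n
    have h3 : ∫ g, c * (X g ^ (2 * n) * Y g) ∂stdMeasure E ≤
        ∫ g, (X g ^ (2 * n + 2) / 2 + c * (2 * c) ^ n * |Y g| ^ 2 ^ (m + 1)) ∂stdMeasure E := by
      refine integral_mono (integrable_of_temperate (by fun_prop)) ?_ fun g => ?_
      · refine Integrable.add ((integrable_of_temperate (by fun_prop)).div_const _) ?_
        refine Integrable.const_mul ?_ _
        have : Even (2 ^ (m + 1)) := by simp [Nat.even_pow]
        simp_rw [this.pow_abs]
        exact integrable_of_temperate (by fun_prop)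
      · have h4 := moment_young (n := n) (sq_nonneg (X g)) (abs_nonneg (Y g)) hc0
        rw [← pow_mul, ← pow_mul, hn1] at h4
        have h5 : c * (X g ^ (2 * n) * Y g) ≤ c * (X g ^ (2 * n) * |Y g|) := by
          have : 0 ≤ X g ^ (2 * n) := by rw [pow_mul]; positivity
          gcongr
          exact le_abs_self _
        rw [← hn1] at h4
        rw [show 2 * (n + 1) = 2 * n + 2 by ring, hn1] at h4
        exact h5.trans h4
    have hYi : Integrable (fun g => |Y g| ^ 2 ^ (m + 1)) (stdMeasure E) := by
      have : Even (2 ^ (m + 1)) := by simp [Nat.even_pow]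
      simp_rw [this.pow_abs]
      exact integrable_of_temperate (by fun_prop)
    have h2' : ∫ g, c * (X g ^ (2 * n) * Y g) ∂stdMeasure E =
        ∫ g, X g ^ (2 * n + 2) ∂stdMeasure E := h2.symm
    rw [h2', integral_add ((integrable_of_temperate (by fun_prop)).div_const _)
      (hYi.const_mul _), integral_div, integral_const_mul, ← nrm_pow hYt] at h3
    have h6 : nrm (m + 1) Y ^ 2 ^ (m + 1) ≤ (|K| + C) ^ (n + 1) := by
      rw [hn1]; exact pow_le_pow_left₀ (nrm_nonneg _ _) hYn _
    have h7 : nrm (m + 1 + 1) X ^ 2 ^ (m + 1 + 1) ≤ B := by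
      rw [h1]
      have := mul_le_mul_of_nonneg_left h6 (by positivity : 0 ≤ c * (2 * c) ^ n)
      linarith
    by_contra hcon
    push Not at hcon
    have h8 : B + 1 ≤ (B + 1) ^ 2 ^ (m + 1 + 1) :=
      le_self_pow₀ (by linarith) (by positivity)
    have h9 := pow_le_pow_left₀ (by positivity) hcon.le (2 ^ (m + 1 + 1))
    linarith

end Divergence

end GaussSpace

namespace TAP

open scoped Classical in
/-- The sites that are met by a list of pairs. -/
noncomputable def verts {N : ℕ} (L : List (Pair N)) : Finset (Fin N) :=
  Finset.univ.filter fun i => ∃ e ∈ L, i ∈ e.1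

/-- The graph whose edges are the entries of a list of pairs. -/
def listGraph {N : ℕ} (L : List (Pair N)) : SimpleGraph (Fin N) where
  Adj i j := ∃ e ∈ L, e.1 = s(i, j)
  symm := ⟨fun _ _ ⟨e, he, h⟩ => ⟨e, he, h.trans Sym2.eq_swap⟩⟩
  loopless := ⟨fun i ⟨e, _, h⟩ => e.2 (by rw [h]; exact Sym2.mk_isDiag_iff.mpr rfl)⟩

/-- The components of a list of pairs that do not contain `p`; isolated sites do not count. -/
def compsAvoiding {N : ℕ} (L : List (Pair N)) (p : Fin N) :
    Set (listGraph L).ConnectedComponent :=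
  {c | ∃ v ∈ verts L, (listGraph L).connectedComponentMk v = c ∧ ¬ (listGraph L).Reachable v p}

/-- The number of components of a list of pairs that do not contain `p`. -/
noncomputable def compCount {N : ℕ} (L : List (Pair N)) (p : Fin N) : ℕ :=
  (compsAvoiding L p).ncard

/-- The pair that joins `p` to another site. -/
def star {N : ℕ} (p : Fin N) (l : {j : Fin N // j ≠ p}) : Pair N := mkPair p l.1 (Ne.symm l.2)

/-! ### Counting components under changes of edges and base point. -/

section Components

variable {N : ℕ} {A B L : List (Pair N)} {p j : Fin N}

theorem mem_verts {i : Fin N} : i ∈ verts L ↔ ∃ e ∈ L, i ∈ e.1 := by simp [verts]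

theorem verts_card_le (L : List (Pair N)) : (verts L).card ≤ 2 * L.length := by
  induction L with
  | nil => simp [verts]
  | cons e L ih =>
    obtain ⟨⟨a, b⟩, he⟩ := e
    have : verts (⟨s(a, b), he⟩ :: L) ⊆ {a, b} ∪ verts L := by
      intro i hi
      obtain ⟨f, hf, hif⟩ := mem_verts.1 hi
      rcases List.mem_cons.1 hf with rfl | hf
      · simp at hif ⊢; tauto
      · exact Finset.mem_union_right _ (mem_verts.2 ⟨f, hf, hif⟩)
    have h1 := Finset.card_le_card this
    have h2 := Finset.card_union_le {a, b} (verts L)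
    have h3 : ({a, b} : Finset (Fin N)).card ≤ 2 := Finset.card_le_two
    simp only [List.length_cons]
    change (verts (⟨s(a, b), he⟩ :: L)).card ≤ _
    omega

theorem star_injective (p : Fin N) : Function.Injective (star p) := by
  intro a b h
  have h1 : s(p, a.1) = s(p, b.1) := congrArg Subtype.val h
  exact Subtype.ext (Sym2.congr_right.1 h1)

theorem listGraph_mono (h : ∀ e ∈ A, e ∈ B) : listGraph A ≤ listGraph B :=
  fun _ _ ⟨e, he, h'⟩ => ⟨e, h e he, h'⟩

theorem adj_mem_verts {v w : Fin N} (h : (listGraph L).Adj v w) : w ∈ verts L := by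
  obtain ⟨e, he, h⟩ := h
  exact mem_verts.2 ⟨e, he, by rw [h]; simp⟩

theorem reachable_mem_verts {v w : Fin N} (hv : v ∈ verts L) (h : (listGraph L).Reachable v w) :
    w ∈ verts L := by
  rw [SimpleGraph.reachable_iff_reflTransGen] at h
  induction h with
  | refl => exact hv
  | tail _ h _ => exact adj_mem_verts h

theorem compCount_nil (p : Fin N) : compCount ([] : List (Pair N)) p = 0 := by
  have : compsAvoiding ([] : List (Pair N)) p = ∅ := by
    ext c; simp [compsAvoiding, verts]
  rw [compCount, this, Set.ncard_empty]

theorem image_compsAvoiding_subset {c : (listGraph L).ConnectedComponent} (hAL : ∀ e ∈ A, e ∈ L)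
    {v : Fin N} (hv : v ∈ verts A) (hc : (listGraph L).connectedComponentMk v = c)
    (hp : ¬ (listGraph A).Reachable v p) :
    c ∈ (SimpleGraph.ConnectedComponent.map (SimpleGraph.Hom.ofLE (listGraph_mono hAL))) ''
      compsAvoiding A p :=
  ⟨(listGraph A).connectedComponentMk v, ⟨v, hv, rfl, hp⟩, by rw [← hc]; rfl⟩

/-- A component of the union that avoids `p` contains a component of `A` or of `B`, which then
avoids `p` too. -/
theorem compCount_le_add (h : ∀ e, e ∈ L ↔ e ∈ A ∨ e ∈ B) (p : Fin N) :
    compCount L p ≤ compCount A p + compCount B p := by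
  have hA : ∀ e ∈ A, e ∈ L := fun e he => (h e).2 (Or.inl he)
  have hB : ∀ e ∈ B, e ∈ L := fun e he => (h e).2 (Or.inr he)
  have hsub : compsAvoiding L p ⊆
      (SimpleGraph.ConnectedComponent.map (SimpleGraph.Hom.ofLE (listGraph_mono hA))) ''
        compsAvoiding A p ∪
      (SimpleGraph.ConnectedComponent.map (SimpleGraph.Hom.ofLE (listGraph_mono hB))) ''
        compsAvoiding B p := by
    rintro c ⟨v, hv, hc, hp⟩
    obtain ⟨e, he, hve⟩ := mem_verts.1 hv
    rcases (h e).1 he with he | he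
    · exact Or.inl (image_compsAvoiding_subset hA (mem_verts.2 ⟨e, he, hve⟩) hc
        fun hr => hp (hr.mono (listGraph_mono hA)))
    · exact Or.inr (image_compsAvoiding_subset hB (mem_verts.2 ⟨e, he, hve⟩) hc
        fun hr => hp (hr.mono (listGraph_mono hB)))
  refine (Set.ncard_le_ncard hsub (Set.toFinite _)).trans ((Set.ncard_union_le _ _).trans ?_)
  exact add_le_add (Set.ncard_image_le (Set.toFinite _)) (Set.ncard_image_le (Set.toFinite _))

/-- In `L` the sites `l` and `p` are connected, so a component avoiding `p` does not use the new
edge and contains a component of `A` that avoids `l`. -/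
theorem compCount_cons_star_le (l : {j : Fin N // j ≠ p})
    (h : ∀ e, e ∈ L ↔ e ∈ A ∨ e = star p l) : compCount L p ≤ compCount A l.1 := by
  have hA : ∀ e ∈ A, e ∈ L := fun e he => (h e).2 (Or.inl he)
  have hadj : (listGraph L).Adj l.1 p :=
    ⟨star p l, (h _).2 (Or.inr rfl), Sym2.eq_swap⟩
  have hsub : compsAvoiding L p ⊆
      (SimpleGraph.ConnectedComponent.map (SimpleGraph.Hom.ofLE (listGraph_mono hA))) ''
        compsAvoiding A l.1 := by
    rintro c ⟨v, hv, hc, hp⟩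
    obtain ⟨e, he, hve⟩ := mem_verts.1 hv
    rcases (h e).1 he with he | rfl
    · exact image_compsAvoiding_subset hA (mem_verts.2 ⟨e, he, hve⟩) hc
        fun hr => hp ((hr.mono (listGraph_mono hA)).trans hadj.reachable)
    · exfalso
      rcases Sym2.mem_iff.1 hve with rfl | rfl
      · exact hp (SimpleGraph.Reachable.refl _)
      · exact hp hadj.reachable
  exact (Set.ncard_le_ncard hsub (Set.toFinite _)).trans (Set.ncard_image_le (Set.toFinite _))

/-- A path can leave its component in `A` only along a star edge, hence only from `p` or from an end
point in `S`. -/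
theorem reachable_of_reachable_star {S : List {j : Fin N // j ≠ p}}
    (h : ∀ e, e ∈ L ↔ e ∈ A ∨ ∃ l ∈ S, e = star p l) {v w : Fin N}
    (hp : ¬ (listGraph A).Reachable v p) (hS : ∀ l ∈ S, ¬ (listGraph A).Reachable v l.1)
    (hr : (listGraph L).Reachable v w) : (listGraph A).Reachable v w := by
  rw [SimpleGraph.reachable_iff_reflTransGen] at hr
  induction hr with
  | refl => exact SimpleGraph.Reachable.refl _
  | @tail w w' _ hadj ih =>
    obtain ⟨e, he, hw⟩ := hadj
    rcases (h e).1 he with he | ⟨l, hl, rfl⟩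
    · exact ih.trans (SimpleGraph.Adj.reachable ⟨e, he, hw⟩)
    · exfalso
      have : w ∈ s(p, l.1) := by
        change s(p, l.1) = s(w, w') at hw
        rw [hw]; simp
      rcases Sym2.mem_iff.1 this with rfl | rfl
      · exact hp ih
      · exact hS l hl ih

open scoped Classical in
/-- Adding edges at `p` and moving the base point to `j` destroys at most one component for every
new end point that was already a vertex. -/
theorem compCount_le_compCount_star (S : List {j : Fin N // j ≠ p}) (j : Fin N)
    (h : ∀ e, e ∈ L ↔ e ∈ A ∨ ∃ l ∈ S, e = star p l) :
    compCount A p ≤ compCount L j + (j :: S.map Subtype.val).countP (· ∈ verts A) := by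
  have hA : ∀ e ∈ A, e ∈ L := fun e he => (h e).2 (Or.inl he)
  set T := (j :: S.map Subtype.val).filter (· ∈ verts A) with hT
  -- These are the components of `A` hit by `j` or a new end point; all others that avoid `p`
  -- survive unchanged in `L`, stay distinct and avoid `j`.
  set R := (fun x => (listGraph A).connectedComponentMk x) '' {x | x ∈ T.toFinset} with hR
  have hRc : R.ncard ≤ (j :: S.map Subtype.val).countP (· ∈ verts A) := by
    refine (Set.ncard_image_le (Set.toFinite _)).trans ?_
    rw [List.countP_eq_length_filter, ← hT]
    have : {x | x ∈ T.toFinset} = (T.toFinset : Set (Fin N)) := rfl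
    rw [this, Set.ncard_coe_finset]
    exact List.toFinset_card_le T
  have hmem : ∀ v ∈ verts A, ∀ x ∈ j :: S.map Subtype.val, (listGraph A).Reachable v x →
      (listGraph A).connectedComponentMk v ∈ R := by
    intro v hv x hx hr
    refine ⟨x, ?_, (SimpleGraph.ConnectedComponent.sound hr).symm⟩
    simp only [hT, Set.mem_ofPred_eq, List.mem_toFinset, List.mem_filter, decide_eq_true_eq]
    exact ⟨hx, reachable_mem_verts hv hr⟩
  have hback : ∀ v ∈ verts A, ¬ (listGraph A).Reachable v p →
      (listGraph A).connectedComponentMk v ∉ R → ∀ w, (listGraph L).Reachable v w →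
        (listGraph A).Reachable v w := by
    intro v hv hp hvR w hr
    refine reachable_of_reachable_star h hp (fun l hl hr' => hvR ?_) hr
    exact hmem v hv l.1 (List.mem_cons_of_mem _ (List.mem_map_of_mem hl)) hr'
  have hinj : (compsAvoiding A p \ R).ncard ≤ compCount L j := by
    refine Set.ncard_le_ncard_of_injOn
      (SimpleGraph.ConnectedComponent.map (SimpleGraph.Hom.ofLE (listGraph_mono hA))) ?_ ?_
      (Set.toFinite _)
    · rintro c ⟨⟨v, hv, rfl, hp⟩, hcR⟩
      refine ⟨v, ?_, rfl, fun hr => hcR ?_⟩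
      · obtain ⟨e, he, hve⟩ := mem_verts.1 hv
        exact mem_verts.2 ⟨e, hA e he, hve⟩
      · exact hmem v hv j List.mem_cons_self (hback v hv hp hcR j hr)
    · rintro c ⟨⟨v, hv, rfl, hp⟩, hcR⟩ c' ⟨⟨w, hw, rfl, hp'⟩, hcR'⟩ heq
      have hr : (listGraph L).Reachable v w := SimpleGraph.ConnectedComponent.exact heq
      exact SimpleGraph.ConnectedComponent.sound (hback v hv hp hcR w hr)
  have hsub : compsAvoiding A p ⊆ (compsAvoiding A p \ R) ∪ R := by
    intro c hc
    by_cases hcR : c ∈ R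
    · exact Or.inr hcR
    · exact Or.inl ⟨hc, hcR⟩
  have h1 := (Set.ncard_le_ncard hsub (Set.toFinite _)).trans (Set.ncard_union_le _ _)
  exact h1.trans (add_le_add hinj hRc)

/-- One inequality suffices: since `√N ≥ 1`, a larger exponent only strengthens the bound. -/
theorem componentsAvoiding_le_compCount {α : MultiIndex N} (hL : ∀ e, e ∈ L ↔ 0 < α e)
    (p : Fin N) : componentsAvoiding α p ≤ compCount L p := by
  have hadj : ∀ {v w}, (listGraph L).Adj v w ↔ (graph α).Adj v w := by
    intro v w
    exact ⟨fun ⟨e, he, h⟩ => ⟨e, h, (hL e).1 he⟩, fun ⟨e, h, he⟩ => ⟨e, (hL e).2 he, h⟩⟩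
  have hind : ∀ (v : (graph α).support) (w : Fin N), (listGraph L).Reachable v w →
      ∃ hw : w ∈ (graph α).support,
        ((graph α).induce (graph α).support).Reachable v ⟨w, hw⟩ := by
    intro v w hr
    rw [SimpleGraph.reachable_iff_reflTransGen] at hr
    induction hr with
    | refl => exact ⟨v.2, SimpleGraph.Reachable.refl _⟩
    | @tail w w' _ h ih =>
      obtain ⟨hw, hr⟩ := ih
      have h' := hadj.1 h
      have hw' : w' ∈ (graph α).support := ⟨w, h'.symm⟩
      refine ⟨hw', hr.trans (SimpleGraph.Adj.reachable ?_)⟩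
      exact h'
  have hex : ∀ c : {c : ((graph α).induce (graph α).support).ConnectedComponent //
      ∀ v ∈ c.supp, (v : Fin N) ≠ p}, ∃ v : (graph α).support,
        ((graph α).induce (graph α).support).connectedComponentMk v = c.1 :=
    fun c => c.1.exists_rep
  choose r hr using hex
  refine (Nat.card_le_card_of_injective
    (β := compsAvoiding L p)
    (fun c => ⟨(listGraph L).connectedComponentMk (r c), r c, ?_, rfl, ?_⟩) ?_).trans_eq
    (Nat.card_coe_set_eq _)
  · obtain ⟨w, hw⟩ := (r c).2
    exact adj_mem_verts (hadj.2 hw.symm)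
  · intro hp
    obtain ⟨hw, hr'⟩ := hind _ _ hp
    refine c.2 ⟨p, hw⟩ ?_ rfl
    rw [SimpleGraph.ConnectedComponent.mem_supp_iff, ← hr c]
    exact (SimpleGraph.ConnectedComponent.sound hr').symm
  · intro c c' h
    have h' : (listGraph L).Reachable (r c) (r c') :=
      SimpleGraph.ConnectedComponent.exact (Subtype.ext_iff.1 h)
    obtain ⟨_, hr'⟩ := hind _ _ h'
    exact Subtype.ext ((hr c).symm.trans ((SimpleGraph.ConnectedComponent.sound hr').trans (hr c')))

end Components

end TAP

namespace GaussSpace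

/-! ### Iterated derivatives along lists. -/

section ListDerivatives

variable {E : Type*} [DecidableEq E]

/-- The iterated partial derivative along a list of coordinates, the first entry being applied
first. -/
noncomputable def listDeriv (L : List E) (F : (E → ℝ) → ℝ) : (E → ℝ) → ℝ :=
  L.foldl (fun H e => pd e H) F

theorem listDeriv_nil (F : (E → ℝ) → ℝ) : listDeriv [] F = F := rfl

theorem listDeriv_cons (e : E) (L : List E) (F : (E → ℝ) → ℝ) :
    listDeriv (e :: L) F = listDeriv L (pd e F) := rfl

theorem listDeriv_append (A B : List E) (F : (E → ℝ) → ℝ) :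
    listDeriv (A ++ B) F = listDeriv B (listDeriv A F) := List.foldl_append

theorem listDeriv_zero (L : List E) :
    listDeriv L (fun _ : E → ℝ => 0) = fun _ => 0 := by
  induction L with
  | nil => rfl
  | cons e L ih => rw [listDeriv_cons, pd_const, ih]

theorem listDeriv_cons_const (e : E) (L : List E) (a : ℝ) :
    listDeriv (e :: L) (fun _ : E → ℝ => a) = fun _ => 0 := by
  rw [listDeriv_cons, pd_const, listDeriv_zero]

variable [Fintype E] {F G : (E → ℝ) → ℝ}

@[fun_prop]
theorem temperate_listDeriv (hF : F.HasTemperateGrowth) (L : List E) :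
    (listDeriv L F).HasTemperateGrowth := by
  induction L generalizing F with
  | nil => exact hF
  | cons e L ih => exact ih (temperate_pd hF e)

theorem listDeriv_add (hF : F.HasTemperateGrowth) (hG : G.HasTemperateGrowth) (L : List E) :
    listDeriv L (fun g => F g + G g) = fun g => listDeriv L F g + listDeriv L G g := by
  induction L generalizing F G with
  | nil => rfl
  | cons e L ih =>
    rw [listDeriv_cons, pd_add hF hG, ih (temperate_pd hF e) (temperate_pd hG e)]; rfl

theorem listDeriv_const_mul (hF : F.HasTemperateGrowth) (a : ℝ) (L : List E) :
    listDeriv L (fun g => a * F g) = fun g => a * listDeriv L F g := by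
  induction L generalizing F with
  | nil => rfl
  | cons e L ih => rw [listDeriv_cons, pd_const_mul hF, ih (temperate_pd hF e)]; rfl

theorem listDeriv_sum {κ : Type*} (s : Finset κ) {f : κ → (E → ℝ) → ℝ}
    (hf : ∀ k, (f k).HasTemperateGrowth) (L : List E) :
    listDeriv L (fun g => ∑ k ∈ s, f k g) = fun g => ∑ k ∈ s, listDeriv L (f k) g := by
  induction L generalizing f with
  | nil => rfl
  | cons e L ih => rw [listDeriv_cons, pd_sum _ hf, ih fun k => temperate_pd (hf k) e]; rfl

/-- Leibniz: every derivative falls on one of the two factors, which gives `2 ^ |L|` splittings of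
`L`. -/
theorem nrm_listDeriv_mul_le (hF : F.HasTemperateGrowth) (hG : G.HasTemperateGrowth) (s : ℕ)
    (L : List E) {M : ℝ}
    (h : ∀ A B : List E, (A ++ B).Perm L →
      nrm s (fun g => listDeriv A F g * listDeriv B G g) ≤ M) :
    nrm s (listDeriv L fun g => F g * G g) ≤ 2 ^ L.length * M := by
  induction L generalizing F G with
  | nil => simpa [listDeriv_nil] using h [] [] (List.Perm.refl _)
  | cons e L ih =>
    have hF' := temperate_pd hF e
    have hG' := temperate_pd hG e
    rw [listDeriv_cons, pd_mul hF hG, listDeriv_add (by fun_prop) (by fun_prop)]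
    refine (nrm_add_le (by fun_prop) s).trans ?_
    have h1 := ih hF' hG fun A B hAB => h (e :: A) B (List.Perm.cons e hAB)
    have h2 := ih hF hG' fun A B hAB =>
      h A (e :: B) (List.perm_middle.trans (List.Perm.cons e hAB))
    rw [List.length_cons, pow_succ]
    linarith

/-- A derivative can hit only the coefficient of its own coordinate, and `e` is injective. Hence
each entry of `L` contributes at most one term to the whole sum over `i`, and no factor of the
dimension appears. -/
theorem nrm_sum_listDeriv_eval_mul_sub_le {ι : Type*} [Fintype ι] {e : ι → E}
    (he : Function.Injective e) {f : ι → (E → ℝ) → ℝ} (hf : ∀ i, (f i).HasTemperateGrowth)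
    (s : ℕ) (L : List E) {M : ℝ} (hM : 0 ≤ M)
    (h : ∀ i B, (e i :: B).Perm L → nrm s (listDeriv B (f i)) ≤ M) :
    nrm s (fun g => ∑ i, (listDeriv L (fun g => g (e i) * f i g) g -
      g (e i) * listDeriv L (f i) g)) ≤ L.length * M := by
  classical
  induction L generalizing f with
  | nil => simp [listDeriv_nil, nrm_zero]
  | cons a L ih =>
    have hf' : ∀ i, (pd a (f i)).HasTemperateGrowth := fun i => temperate_pd (hf i) a
    have h1 : ∀ i, listDeriv (a :: L) (fun g => g (e i) * f i g) = fun g =>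
        (if e i = a then 1 else 0) * listDeriv L (f i) g +
          listDeriv L (fun g => g (e i) * pd a (f i) g) g := by
      intro i
      have := hf i
      rw [listDeriv_cons, pd_mul (by fun_prop) (by fun_prop), pd_eval,
        listDeriv_add (by fun_prop) (by fun_prop), listDeriv_const_mul (hf i)]
    have h2 : (fun g => ∑ i, (listDeriv (a :: L) (fun g => g (e i) * f i g) g -
        g (e i) * listDeriv (a :: L) (f i) g)) = fun g =>
        (∑ i, (if e i = a then 1 else 0) * listDeriv L (f i) g) +
          ∑ i, (listDeriv L (fun g => g (e i) * pd a (f i) g) g -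
            g (e i) * listDeriv L (pd a (f i)) g) := by
      funext g
      rw [← Finset.sum_add_distrib]
      refine Finset.sum_congr rfl fun i _ => ?_
      rw [h1, listDeriv_cons]; ring
    rw [h2]
    refine (nrm_add_le (by fun_prop) s).trans ?_
    have h3 := ih hf' fun i B hB => by
      rw [← listDeriv_cons]
      exact h i (a :: B) ((List.Perm.swap a (e i) B).trans (List.Perm.cons a hB))
    have h4 : nrm s (fun g => ∑ i, (if e i = a then 1 else 0) * listDeriv L (f i) g) ≤ M := by
      by_cases hex : ∃ i, e i = a
      · obtain ⟨i, rfl⟩ := hex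
        have : (fun g => ∑ j, (if e j = e i then 1 else 0) * listDeriv L (f j) g) =
            listDeriv L (f i) := by
          funext g; simp [he.eq_iff]
        rw [this]
        exact h i L (List.Perm.refl _)
      · push Not at hex
        simpa [hex, nrm_zero] using hM
    push_cast [List.length_cons]
    linarith

/-- With multiplicative weights, each further order of differentiation costs a factor `1 + W`,
however many directions there are. -/
theorem sob_le_of_listDeriv_le {ι : Type*} [Fintype ι] {e : ι → E} {w : ι → ℝ}
    (hw : ∀ i, 0 ≤ w i) {s r : ℕ} {κ W : ℝ} (hκ : 0 ≤ κ) (hW : ∑ i, w i ≤ W)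
    (h : ∀ S : List ι, S.length ≤ r →
      nrm s (listDeriv (S.map e) F) ^ 2 ≤ κ * (S.map w).prod) :
    sob e s r F ≤ κ * (1 + W) ^ r := by
  have hW0 : 0 ≤ W := (Finset.sum_nonneg fun i _ => hw i).trans hW
  have h0 : nrm s F ^ 2 ≤ κ := by simpa [listDeriv_nil] using h [] (Nat.zero_le _)
  induction r generalizing F κ with
  | zero => simpa [sob] using h0
  | succ r ih =>
    have h1 : ∀ l, sob e s r (pd (e l) F) ≤ κ * w l * (1 + W) ^ r := by
      intro l
      refine ih (mul_nonneg hκ (hw l)) (fun S hS => ?_) ?_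
      · have := h (l :: S) (by simpa using hS)
        simpa [listDeriv_cons, mul_assoc] using this
      · simpa [listDeriv_cons, listDeriv_nil] using h [l] (by simp)
    have h2 : ∑ l, sob e s r (pd (e l) F) ≤ κ * W * (1 + W) ^ r := by
      refine (Finset.sum_le_sum fun l _ => h1 l).trans ?_
      rw [← Finset.sum_mul, ← Finset.mul_sum]
      gcongr
    have h3 : (1 : ℝ) ≤ (1 + W) ^ r := one_le_pow₀ (by linarith)
    simp only [sob]
    rw [pow_succ (1 + W)]
    nlinarith [mul_le_mul_of_nonneg_left h3 hκ]

end ListDerivatives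

/-! ### Derivatives of the hyperbolic tangent. -/

section Tanh

theorem hasDerivAt_tanh (x : ℝ) : HasDerivAt Real.tanh (1 - Real.tanh x ^ 2) x := by
  have hc : Real.cosh x ≠ 0 := (Real.cosh_pos x).ne'
  have h := (Real.hasDerivAt_sinh x).div (Real.hasDerivAt_cosh x) hc
  have e : (Real.sinh / Real.cosh) = Real.tanh := by
    funext y; exact (Real.tanh_eq_sinh_div_cosh y).symm
  rw [e] at h
  convert! h using 1
  rw [Real.tanh_eq_sinh_div_cosh]
  field_simp

/-- As `tanh` takes values in `[-1, 1]`, this form makes all derivatives bounded. -/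
theorem iteratedDeriv_tanh (n : ℕ) :
    ∃ P : Polynomial ℝ, iteratedDeriv n Real.tanh = fun x => P.eval (Real.tanh x) := by
  induction n with
  | zero => exact ⟨Polynomial.X, by simp⟩
  | succ n ih =>
    obtain ⟨P, hP⟩ := ih
    refine ⟨P.derivative * (1 - Polynomial.X ^ 2), ?_⟩
    rw [iteratedDeriv_succ, hP]
    funext x
    have := ((P.hasDerivAt (Real.tanh x)).comp x (hasDerivAt_tanh x)).deriv
    simpa [Function.comp_def] using this

@[fun_prop]
theorem temperate_tanh : Real.tanh.HasTemperateGrowth := by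
  have hd : ContDiff ℝ ((⊤ : ℕ∞) : WithTop ℕ∞) Real.tanh := by
    have e : Real.tanh = fun x => Real.sinh x / Real.cosh x := by
      funext y; exact Real.tanh_eq_sinh_div_cosh y
    rw [e]
    exact Real.contDiff_sinh.div Real.contDiff_cosh fun x => (Real.cosh_pos x).ne'
  refine ⟨hd, fun n => ?_⟩
  obtain ⟨P, hP⟩ := iteratedDeriv_tanh n
  obtain ⟨C, hC⟩ := (isCompact_Icc (a := (-1 : ℝ)) (b := 1)).exists_bound_of_continuousOn
    P.continuous.continuousOn
  refine ⟨0, C, fun x => ?_⟩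
  rw [norm_iteratedFDeriv_eq_norm_iteratedDeriv, hP, pow_zero, mul_one]
  exact hC _ ⟨(Real.neg_one_lt_tanh x).le, (Real.tanh_lt_one x).le⟩

theorem temperate_comp_tanh {V : Type*} [NormedAddCommGroup V] [NormedSpace ℝ V] {F : V → ℝ}
    (hF : F.HasTemperateGrowth) : (fun g => Real.tanh (F g)).HasTemperateGrowth :=
  temperate_tanh.comp hF

end Tanh

end GaussSpace

namespace TAP

open GaussSpace

/-! ### Scaled derivative bounds. -/

section Scaled

variable {N : ℕ}

theorem one_le_sqrt_card (p : Fin N) : 1 ≤ √(N : ℝ) := by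
  rw [Real.one_le_sqrt]
  exact_mod_cast p.pos

/-- The derivatives of `F` along lists of at most `n` pairs, scaled according to the order and
the number of components of the list extended by `P`, are bounded in norm. -/
def ScaledBdd (P : List (Pair N)) (p : Fin N) (n s : ℕ) (K : ℝ) (F : Disorder N → ℝ) : Prop :=
  ∀ L : List (Pair N), L.length ≤ n →
    √(N : ℝ) ^ ((P ++ L).length + compCount (P ++ L) p) * nrm s (listDeriv L F) ≤ K

variable {P : List (Pair N)} {p : Fin N} {n s : ℕ} {K K' : ℝ} {F G : Disorder N → ℝ}

theorem ScaledBdd.add (hF : F.HasTemperateGrowth) (hG : G.HasTemperateGrowth)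
    (h : ScaledBdd P p n s K F) (h' : ScaledBdd P p n s K' G) :
    ScaledBdd P p n s (K + K') fun g => F g + G g := by
  intro L hL
  rw [listDeriv_add hF hG]
  refine le_trans ?_ (add_le_add (h L hL) (h' L hL))
  rw [← mul_add]
  gcongr
  exact nrm_add_le (by fun_prop) s

theorem ScaledBdd.const_mul (hF : F.HasTemperateGrowth) (h : ScaledBdd P p n s K F) (a : ℝ) :
    ScaledBdd P p n s (|a| * K) fun g => a * F g := by
  intro L hL
  rw [listDeriv_const_mul hF, nrm_const_mul, mul_left_comm]
  gcongr
  exact h L hL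

theorem scaledBdd_const (a : ℝ) : ScaledBdd [] p n s |a| fun _ => a := by
  intro L hL
  cases L with
  | nil => simp [compCount_nil, listDeriv_nil, nrm_const]
  | cons e L => rw [listDeriv_cons_const, nrm_zero, mul_zero]; exact abs_nonneg a

theorem ScaledBdd.mul (hF : F.HasTemperateGrowth) (hG : G.HasTemperateGrowth) (hK : 0 ≤ K)
    (h : ScaledBdd [] p n (s + 1) K F) (h' : ScaledBdd P p n (s + 1) K' G) :
    ScaledBdd P p n s (2 ^ n * (K * K')) fun g => F g * G g := by
  intro L hL
  have hN := one_le_sqrt_card p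
  set w := √(N : ℝ) ^ ((P ++ L).length + compCount (P ++ L) p) with hw
  have hw0 : 0 < w := by positivity
  have hK' : 0 ≤ K' :=
    (mul_nonneg (by positivity) (nrm_nonneg _ _)).trans (h' [] (Nat.zero_le _))
  have key : nrm s (listDeriv L fun g => F g * G g) ≤ 2 ^ L.length * (K * K' / w) := by
    refine nrm_listDeriv_mul_le hF hG s L fun A B hAB => ?_
    rw [le_div_iff₀ hw0]
    have hlen : A.length + B.length = L.length := by
      rw [← List.length_append]; exact hAB.length_eq
    have hcount : compCount (P ++ L) p ≤ compCount ([] ++ A) p + compCount (P ++ B) p := by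
      refine compCount_le_add (fun e => ?_) p
      rw [List.nil_append, List.mem_append, List.mem_append, ← hAB.mem_iff, List.mem_append]
      tauto
    have hwle : w ≤ √(N : ℝ) ^ (([] ++ A).length + compCount ([] ++ A) p) *
        √(N : ℝ) ^ ((P ++ B).length + compCount (P ++ B) p) := by
      rw [hw, ← pow_add]
      refine pow_le_pow_right₀ hN ?_
      simp only [List.length_append, List.length_nil] at hcount ⊢
      omega
    calc nrm s (fun g => listDeriv A F g * listDeriv B G g) * w
        ≤ (nrm (s + 1) (listDeriv A F) * nrm (s + 1) (listDeriv B G)) *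
          (√(N : ℝ) ^ (([] ++ A).length + compCount ([] ++ A) p) *
            √(N : ℝ) ^ ((P ++ B).length + compCount (P ++ B) p)) := by
          refine mul_le_mul (nrm_mul_le (by fun_prop) (by fun_prop) s) hwle hw0.le ?_
          exact mul_nonneg (nrm_nonneg _ _) (nrm_nonneg _ _)
      _ = (√(N : ℝ) ^ (([] ++ A).length + compCount ([] ++ A) p) *
            nrm (s + 1) (listDeriv A F)) *
          (√(N : ℝ) ^ ((P ++ B).length + compCount (P ++ B) p) *
            nrm (s + 1) (listDeriv B G)) := by ring
      _ ≤ K * K' := by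
          refine mul_le_mul (h A (by omega)) (h' B (by omega)) ?_ hK
          exact mul_nonneg (by positivity) (nrm_nonneg _ _)
  calc w * nrm s (listDeriv L fun g => F g * G g)
      ≤ w * (2 ^ L.length * (K * K' / w)) := by gcongr
    _ = 2 ^ L.length * (K * K') := by field_simp
    _ ≤ 2 ^ n * (K * K') := by
        gcongr
        norm_num

theorem ScaledBdd.mono {m : ℕ} (h : ScaledBdd P p n s K F) (hm : m ≤ n) (hK : K ≤ K') :
    ScaledBdd P p m s K' F := fun L hL => (h L (hL.trans hm)).trans hK

/-- The prefix remembers the derivative already taken, so its share of the scaling survives when the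
chain rule is combined with `ScaledBdd.mul`. -/
theorem ScaledBdd.pd (h : ScaledBdd [] p (n + 1) s K F) (e : Pair N) :
    ScaledBdd [e] p n s K (pd e F) := by
  intro L hL
  have := h (e :: L) (by simpa using hL)
  rwa [listDeriv_cons] at this

end Scaled

/-! ### Site weights that make sums over end points converge. -/

section Weights

variable {N : ℕ}

open scoped Classical in
/-- The weight of a site in sums over end points of new edges. -/
noncomputable def siteWeight (L : List (Pair N)) (x : Fin N) : ℝ :=
  if x ∈ verts L then 1 else (√(N : ℝ))⁻¹

variable {L L' : List (Pair N)} {p j : Fin N} {K a : ℝ}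

theorem siteWeight_nonneg (x : Fin N) : 0 ≤ siteWeight L x := by
  unfold siteWeight; split_ifs <;> positivity

theorem inv_sqrt_le_siteWeight (x : Fin N) : (√(N : ℝ))⁻¹ ≤ siteWeight L x := by
  unfold siteWeight
  split_ifs
  · exact inv_le_one_of_one_le₀ (one_le_sqrt_card x)
  · exact le_rfl

/-- At most `2|L|` sites have weight one, and the others contribute at most `N * N⁻¹`. -/
theorem sum_siteWeight_sq_le (L : List (Pair N)) :
    ∑ x, siteWeight L x ^ 2 ≤ 2 * L.length + 1 := by
  classical
  have h1 : ∀ x, siteWeight L x ^ 2 ≤ (if x ∈ verts L then 1 else 0) + (N : ℝ)⁻¹ := by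
    intro x
    unfold siteWeight
    split_ifs
    · simp
    · rw [inv_pow, Real.sq_sqrt (by positivity)]; simp
  refine (Finset.sum_le_sum fun x _ => h1 x).trans ?_
  rw [Finset.sum_add_distrib]
  have h2 : ((verts L).card : ℝ) ≤ 2 * L.length := by exact_mod_cast verts_card_le L
  have h3 : (N : ℝ) * (N : ℝ)⁻¹ ≤ 1 := mul_inv_le_one
  simp only [Finset.sum_ite_mem, Finset.univ_inter, Finset.sum_const, Finset.card_univ,
    Fintype.card_fin, nsmul_eq_mul, mul_one]
  linarith

theorem sum_siteWeight_star_sq_le (L : List (Pair N)) (p : Fin N) :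
    ∑ l : {j : Fin N // j ≠ p}, siteWeight L l.1 ^ 2 ≤ 2 * L.length + 1 := by
  rw [← Finset.sum_subtype (Finset.univ.filter (· ≠ p)) (by simp) (fun x => siteWeight L x ^ 2)]
  exact (Finset.sum_le_sum_of_subset_of_nonneg (Finset.filter_subset _ _)
    fun _ _ _ => sq_nonneg _).trans (sum_siteWeight_sq_le L)

open scoped Classical in
theorem sqrt_pow_length_mul_prod_siteWeight (hN : 0 < √(N : ℝ)) (T : List (Fin N)) :
    √(N : ℝ) ^ T.length * (T.map (siteWeight L)).prod =
      √(N : ℝ) ^ T.countP (· ∈ verts L) := by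
  induction T with
  | nil => simp
  | cons x T ih =>
    rw [List.map_cons, List.prod_cons, List.length_cons, pow_succ, List.countP_cons]
    by_cases hx : x ∈ verts L
    · simp only [siteWeight, hx, if_true, decide_true, pow_succ, ← ih]; ring
    · simp only [siteWeight, hx, if_false, decide_false, Bool.false_eq_true, add_zero, ← ih]
      field_simp

/-- Comparison of the scaling factors before and after adding edges at `p` and moving the base
point from `p` to `j`. -/
theorem inv_sqrt_mul_scaled_le (S : List {j : Fin N // j ≠ p})
    (hmem : ∀ e, e ∈ L' ↔ e ∈ L ∨ ∃ l ∈ S, e = star p l)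
    (hlen : L'.length = L.length + S.length) (ha : 0 ≤ a)
    (h : √(N : ℝ) ^ (L'.length + compCount L' j) * a ≤ K) :
    (√(N : ℝ))⁻¹ * √(N : ℝ) ^ (L.length + compCount L p) * a ≤
      K * (siteWeight L j * (S.map fun l => siteWeight L l.1).prod) := by
  classical
  have hN := one_le_sqrt_card p
  have hN0 : 0 < √(N : ℝ) := by linarith
  have hT := sqrt_pow_length_mul_prod_siteWeight (L := L) hN0 (j :: S.map Subtype.val)
  have hcount := compCount_le_compCount_star (A := L) (L := L') S j hmem
  set c := (j :: S.map Subtype.val).countP (· ∈ verts L)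
  simp only [List.map_cons, List.prod_cons, List.map_map, List.length_cons, List.length_map] at hT
  change _ * (siteWeight L j * (S.map fun l => siteWeight L l.1).prod) = _ at hT
  -- Multiplication by this power turns the product of weights into `√N ^ c`, where `c` counts the
  -- end points already in `L`, the most components that can be lost.
  have h0 : 0 < √(N : ℝ) ^ (S.length + 1) := by positivity
  refine le_of_mul_le_mul_left ?_ h0
  calc √(N : ℝ) ^ (S.length + 1) *
        ((√(N : ℝ))⁻¹ * √(N : ℝ) ^ (L.length + compCount L p) * a)
      = √(N : ℝ) ^ (S.length + (L.length + compCount L p)) * a := by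
        rw [pow_succ, pow_add _ S.length]; field_simp
    _ ≤ √(N : ℝ) ^ (L'.length + compCount L' j + c) * a := by
        exact mul_le_mul_of_nonneg_right (pow_le_pow_right₀ hN (by omega)) ha
    _ = √(N : ℝ) ^ (L'.length + compCount L' j) * a * √(N : ℝ) ^ c := by rw [pow_add]; ring
    _ ≤ K * √(N : ℝ) ^ c := by gcongr
    _ = _ := by rw [← hT]; ring

/-- The site `l` is both the new end point and the new base point, so its weight occurs squared and
is summable. -/
theorem sum_inv_sqrt_mul_scaled_le {f : {j : Fin N // j ≠ p} → Disorder N → ℝ} {n s : ℕ}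
    (hK : 0 ≤ K) (hf : ∀ l, ScaledBdd [] l.1 (n + 1) s K (f l)) (hn : L.length ≤ n)
    (L' : {j : Fin N // j ≠ p} → List (Pair N)) (hL' : ∀ l, (L' l).Perm (star p l :: L)) :
    ∑ l, (√(N : ℝ))⁻¹ * √(N : ℝ) ^ (L.length + compCount L p) *
      nrm s (listDeriv (L' l) (f l)) ≤ K * (2 * n + 1) := by
  have h1 : ∀ l, (√(N : ℝ))⁻¹ * √(N : ℝ) ^ (L.length + compCount L p) *
      nrm s (listDeriv (L' l) (f l)) ≤ K * siteWeight L l.1 ^ 2 := by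
    intro l
    have hlen : (L' l).length = L.length + 1 := by simpa using (hL' l).length_eq
    have := inv_sqrt_mul_scaled_le (L := L) (L' := L' l) (p := p) (j := l.1) [l]
      (fun e => by rw [(hL' l).mem_iff]; simp [or_comm]) (by simpa using hlen) (nrm_nonneg _ _)
      (hf l (L' l) (by omega))
    simpa [sq] using this
  refine (Finset.sum_le_sum fun l _ => h1 l).trans ?_
  rw [← Finset.mul_sum]
  gcongr
  refine (sum_siteWeight_star_sq_le L p).trans ?_
  have : (L.length : ℝ) ≤ n := by exact_mod_cast hn
  linarith

end Weights

end TAP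

namespace TAP

open GaussSpace

/-! ### The Gaussian field as a divergence. -/

section Field

theorem list_prod_map_sq {ι : Type*} (w : ι → ℝ) (S : List ι) :
    (S.map fun l => w l ^ 2).prod = (S.map w).prod ^ 2 := by
  induction S with
  | nil => simp
  | cons l S ih => simp [ih, mul_pow]

/-- The normalized Gaussian field `N^(-1/2) ∑ l, g_{pl} f_l` satisfies scaled bounds at `p` if the
`f_l` satisfy scaled bounds at `l` of a higher order. -/
theorem exists_scaledBdd_field (n s : ℕ) {K : ℝ} (hK : 0 ≤ K) : ∃ K' : ℝ, 0 ≤ K' ∧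
    ∀ (N : ℕ) (p : Fin N) (f : {j : Fin N // j ≠ p} → Disorder N → ℝ),
      (∀ l, (f l).HasTemperateGrowth) →
      (∀ l, ScaledBdd [] l.1 (n + s + 1) (s + 1) K (f l)) →
      ScaledBdd [] p n (s + 1) K' fun g => (√(N : ℝ))⁻¹ * ∑ l, g (star p l) * f l g := by
  set W : ℝ := 2 * n + 1 with hW
  have hW0 : 0 ≤ W := by positivity
  -- One `W` sums over the components of the vector field, and the factors `1 + W` come from its `s
  -- + 1` Sobolev derivatives.
  obtain ⟨C, hC0, hC⟩ := exists_nrm_gaussDiv_le s (K ^ 2 * W * (1 + W) ^ (s + 1))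
  refine ⟨n * K + (C + K * W), by positivity, ?_⟩
  intro N p f hf hb L hL
  have hN := one_le_sqrt_card p
  have hN0 : 0 < √(N : ℝ) := by linarith
  have hLn : (L.length : ℝ) ≤ n := by exact_mod_cast hL
  rw [List.nil_append]
  set a := L.length + compCount L p with ha
  set c := (√(N : ℝ))⁻¹ * √(N : ℝ) ^ a with hc
  have hc0 : 0 < c := by positivity
  have hgf : ∀ l, (fun g : Disorder N => g (star p l) * f l g).HasTemperateGrowth := by
    intro l; have := hf l; fun_prop
  have hsum : (fun g : Disorder N => ∑ l, g (star p l) * f l g).HasTemperateGrowth := by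
    fun_prop
  rw [listDeriv_const_mul hsum, nrm_const_mul, abs_of_nonneg (by positivity), ← mul_assoc,
    mul_comm (√(N : ℝ) ^ a), ← hc, listDeriv_sum _ hgf]
  have hsplit : (fun g => ∑ l, listDeriv L (fun g => g (star p l) * f l g) g) = fun g =>
      (∑ l, (listDeriv L (fun g => g (star p l) * f l g) g -
        g (star p l) * listDeriv L (f l) g)) + ∑ l, g (star p l) * listDeriv L (f l) g := by
    funext g
    rw [← Finset.sum_add_distrib]
    exact Finset.sum_congr rfl fun l _ => by ring
  rw [hsplit]
  have hdL : ∀ l, (listDeriv L (f l)).HasTemperateGrowth := fun l => temperate_listDeriv (hf l) L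
  -- When a derivative consumes `g_{pl}`, the remaining list is one shorter, which matches the
  -- prefactor `N^(-1/2)`, and moving the base point to `l` loses no component.
  have hcomm : c * nrm (s + 1) (fun g => ∑ l, (listDeriv L (fun g => g (star p l) * f l g) g -
      g (star p l) * listDeriv L (f l) g)) ≤ n * K := by
    have h1 := nrm_sum_listDeriv_eval_mul_sub_le (star_injective p) hf (s + 1) L (M := K / c)
      (by positivity) fun l B hB => by
        rw [le_div_iff₀ hc0, mul_comm]
        have hlen : B.length + 1 = L.length := by simpa using hB.length_eq
        have hcount : compCount L p ≤ compCount B l.1 :=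
          compCount_cons_star_le l fun e => by
            rw [← hB.mem_iff, List.mem_cons, or_comm]
        refine le_trans ?_ (hb l B (by omega))
        rw [List.nil_append]
        have hcB : c ≤ √(N : ℝ) ^ (B.length + compCount B l.1) := by
          have : c = √(N : ℝ) ^ (B.length + compCount L p) := by
            rw [hc, ha, ← hlen, show B.length + 1 + compCount L p =
              (B.length + compCount L p) + 1 by ring, pow_succ]
            field_simp
          rw [this]
          exact pow_le_pow_right₀ hN (by omega)
        exact mul_le_mul_of_nonneg_right hcB (nrm_nonneg _ _)
    calc _ ≤ c * (L.length * (K / c)) := by gcongr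
      _ = L.length * K := by field_simp
      _ ≤ n * K := by gcongr
  set u : {j : Fin N // j ≠ p} → Disorder N → ℝ := fun l g => c * listDeriv L (f l) g with hu
  have hut : ∀ l, (u l).HasTemperateGrowth := fun l => by rw [hu]; have := hdL l; fun_prop
  have hpdt : ∀ l, (pd (star p l) (u l)).HasTemperateGrowth := fun l => temperate_pd (hut l) _
  have hdivu : nrm (s + 1) (gaussDiv (star p) u) ≤ C := by
    refine hC _ _ (star p) u (star_injective p) hut ?_
    have h1 : ∀ l, sob (star p) (s + 1) (s + 1) (u l) ≤
        K ^ 2 * siteWeight L l.1 ^ 2 * (1 + W) ^ (s + 1) := by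
      intro l
      refine sob_le_of_listDeriv_le (w := fun l => siteWeight L l.1 ^ 2)
        (fun _ => sq_nonneg _) (by positivity) ?_ fun S hS => ?_
      · refine (sum_siteWeight_star_sq_le L p).trans ?_
        linarith
      · rw [hu, listDeriv_const_mul (hdL l), nrm_const_mul, abs_of_pos hc0, ← listDeriv_append]
        have h3 := inv_sqrt_mul_scaled_le (L := L) (L' := L ++ S.map (star p)) (p := p)
          (j := l.1) S (fun e => by simp [eq_comm]) (by simp) (nrm_nonneg _ _)
          (hb l (L ++ S.map (star p)) (by simp; omega))
        refine (pow_le_pow_left₀ (mul_nonneg hc0.le (nrm_nonneg _ _)) h3 2).trans_eq ?_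
        rw [mul_pow, mul_pow, list_prod_map_sq]
        ring
    refine (Finset.sum_le_sum fun l _ => h1 l).trans ?_
    rw [← Finset.sum_mul, ← Finset.mul_sum]
    gcongr
    refine (sum_siteWeight_star_sq_le L p).trans ?_
    linarith
  have hpdu : nrm (s + 1) (fun g => ∑ l, pd (star p l) (u l) g) ≤ K * W := by
    refine (nrm_sum_le _ hpdt _).trans ?_
    refine le_trans (Finset.sum_le_sum fun l _ => ?_)
      (sum_inv_sqrt_mul_scaled_le (p := p) hK (fun l => (hb l).mono (by omega) le_rfl) hL
        (fun l => L ++ [star p l]) fun l => List.perm_append_singleton _ _)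
    rw [hu, pd_const_mul (hdL l), nrm_const_mul, abs_of_pos hc0, listDeriv_append]
    exact le_rfl
  -- By definition of the divergence, `∑ g_{pl} u_l = δ(u) + ∑ ∂_{pl} u_l`.
  have hmain : c * nrm (s + 1) (fun g => ∑ l, g (star p l) * listDeriv L (f l) g) ≤
      C + K * W := by
    have h1 : (fun g => c * ∑ l, g (star p l) * listDeriv L (f l) g) = fun g =>
        gaussDiv (star p) u g + ∑ l, pd (star p l) (u l) g := by
      funext g
      rw [gaussDiv, ← Finset.sum_add_distrib, Finset.mul_sum]
      exact Finset.sum_congr rfl fun l _ => by simp only [hu]; ring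
    have h2 := nrm_const_mul c (fun g => ∑ l, g (star p l) * listDeriv L (f l) g) (s + 1)
    rw [abs_of_pos hc0] at h2
    rw [← h2, h1]
    exact (nrm_add_le (temperate_gaussDiv hut) _).trans (add_le_add hdivu hpdu)
  refine (mul_le_mul_of_nonneg_left (nrm_add_le (by fun_prop) (s + 1)) hc0.le).trans ?_
  rw [mul_add]
  exact add_le_add hcomm hmain

end Field

/-! ### Closure properties of the class of good families. -/

section Good

variable {Θ : Type*} {N : Θ → ℕ}

/-- Families of vectors whose components are of temperate growth with uniform scaled bounds of all
orders in all norms. -/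
def Good (N : Θ → ℕ) (F : ∀ θ, Fin (N θ) → Disorder (N θ) → ℝ) : Prop :=
  (∀ θ p, (F θ p).HasTemperateGrowth) ∧
    ∀ n s, ∃ K : ℝ, 0 ≤ K ∧ ∀ θ p, ScaledBdd [] p n s K (F θ p)

variable {F G : ∀ θ, Fin (N θ) → Disorder (N θ) → ℝ}

theorem Good.add (hF : Good N F) (hG : Good N G) : Good N fun θ p g => F θ p g + G θ p g := by
  refine ⟨fun θ p => by have := hF.1 θ p; have := hG.1 θ p; fun_prop, fun n s => ?_⟩
  obtain ⟨K, hK0, hK⟩ := hF.2 n s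
  obtain ⟨K', hK0', hK'⟩ := hG.2 n s
  exact ⟨K + K', by positivity, fun θ p => (hK θ p).add (hF.1 θ p) (hG.1 θ p) (hK' θ p)⟩

theorem Good.const_mul (hF : Good N F) (a : ℝ) : Good N fun θ p g => a * F θ p g := by
  refine ⟨fun θ p => by have := hF.1 θ p; fun_prop, fun n s => ?_⟩
  obtain ⟨K, hK0, hK⟩ := hF.2 n s
  exact ⟨|a| * K, by positivity, fun θ p => (hK θ p).const_mul (hF.1 θ p) a⟩

theorem good_const {a : ∀ θ, Fin (N θ) → ℝ} {C : ℝ} (hC : 0 ≤ C) (h : ∀ θ p, |a θ p| ≤ C) :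
    Good N fun θ p _ => a θ p :=
  ⟨fun θ p => by fun_prop, fun n s =>
    ⟨C, hC, fun θ p => (scaledBdd_const (a θ p)).mono le_rfl (h θ p)⟩⟩

theorem Good.mul (hF : Good N F) (hG : Good N G) : Good N fun θ p g => F θ p g * G θ p g := by
  refine ⟨fun θ p => by have := hF.1 θ p; have := hG.1 θ p; fun_prop, fun n s => ?_⟩
  obtain ⟨K, hK0, hK⟩ := hF.2 n (s + 1)
  obtain ⟨K', hK0', hK'⟩ := hG.2 n (s + 1)
  exact ⟨2 ^ n * (K * K'), by positivity,
    fun θ p => (hK θ p).mul (hF.1 θ p) (hG.1 θ p) hK0 (hK' θ p)⟩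

/-- At order zero `|tanh| ≤ 1` is enough, and at higher orders `h` disappears from the inner
derivative; hence the uniformity in `h`. The induction runs over the order for all exponents at
once, because products cost exponents. -/
theorem Good.tanh (hF : Good N F) (h : Θ → ℝ) :
    Good N fun θ p g => Real.tanh (h θ + F θ p g) := by
  have ht : ∀ θ p, (fun g => Real.tanh (h θ + F θ p g)).HasTemperateGrowth := fun θ p =>
    temperate_comp_tanh (by have := hF.1 θ p; fun_prop)
  refine ⟨ht, fun n => ?_⟩
  have hbase : ∀ (s : ℕ) θ p, √(N θ : ℝ) ^ (([] ++ [] : List (Pair (N θ))).length +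
      compCount ([] ++ []) p) * nrm s (listDeriv [] fun g => Real.tanh (h θ + F θ p g)) ≤ 1 := by
    intro s θ p
    simp only [List.append_nil, List.length_nil, compCount_nil, add_zero, pow_zero, one_mul, listDeriv_nil]
    exact nrm_le_of_abs_le (fun g => (Real.abs_tanh_lt_one _).le) s
  induction n with
  | zero =>
    refine fun s => ⟨1, zero_le_one, fun θ p L hL => ?_⟩
    obtain rfl := List.length_eq_zero_iff.1 (Nat.le_zero.1 hL)
    exact hbase s θ p
  | succ n ih =>
    intro s
    obtain ⟨K, hK0, hK⟩ := ih (s + 1 + 1)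
    obtain ⟨K', hK0', hK'⟩ := hF.2 (n + 1) (s + 1)
    refine ⟨1 + 2 ^ n * ((|1| + |-1| * (2 ^ n * (K * K))) * K'), by positivity,
      fun θ p L hL => ?_⟩
    cases L with
    | nil =>
      refine (hbase s θ p).trans (le_add_of_nonneg_right (by positivity))
    | cons e L =>
      have hFt := hF.1 θ p
      have htt := ht θ p
      have h1 := (scaledBdd_const (p := p) (n := n) (s := s + 1) 1).add (by fun_prop)
        (by fun_prop) (((hK θ p).mul htt htt hK0 (hK θ p)).const_mul (by fun_prop) (-1))
      have h2 := h1.mul (by fun_prop) (temperate_pd hFt e) (by positivity)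
        ((hK' θ p).pd e)
      have h3 : pd e (fun g => Real.tanh (h θ + F θ p g)) = fun g =>
          (1 + (-1) * (Real.tanh (h θ + F θ p g) * Real.tanh (h θ + F θ p g))) *
            pd e (F θ p) g := by
        rw [pd_comp hasDerivAt_tanh (by fun_prop), pd_add (by fun_prop) hFt, pd_const]
        funext g; ring
      rw [listDeriv_cons, h3]
      exact (h2 L (by simpa using hL)).trans (le_add_of_nonneg_left zero_le_one)

/-- Moving the base point to `j` gives one weight; half of the prefactor `1/N` pays for this, and
the other half is at most a second weight. -/
theorem Good.average (hF : Good N F) :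
    Good N fun θ _ g => (1 / (N θ : ℝ)) * ∑ j, F θ j g := by
  refine ⟨fun θ p => by have := hF.1 θ; fun_prop, fun n s => ?_⟩
  obtain ⟨K, hK0, hK⟩ := hF.2 n s
  refine ⟨K * (2 * n + 1), by positivity, fun θ p L hL => ?_⟩
  have hN := one_le_sqrt_card p
  have hN0 : 0 < √(N θ : ℝ) := by linarith
  have hNN : (1 : ℝ) / N θ = (√(N θ : ℝ))⁻¹ * (√(N θ : ℝ))⁻¹ := by
    rw [← mul_inv, Real.mul_self_sqrt (by positivity), one_div]
  rw [listDeriv_const_mul (by have := hF.1 θ; fun_prop), listDeriv_sum _ (hF.1 θ),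
    nrm_const_mul, abs_of_nonneg (by positivity), List.nil_append]
  have h1 : ∀ j, (√(N θ : ℝ))⁻¹ * ((√(N θ : ℝ))⁻¹ *
      √(N θ : ℝ) ^ (L.length + compCount L p) * nrm s (listDeriv L (F θ j))) ≤
      K * siteWeight L j ^ 2 := by
    intro j
    have h2 := inv_sqrt_mul_scaled_le (L := L) (L' := L) (p := p) (j := j) []
      (fun e => by simp) (by simp) (nrm_nonneg _ _) (hK θ j L hL)
    rw [List.map_nil, List.prod_nil, mul_one] at h2
    calc _ ≤ (√(N θ : ℝ))⁻¹ * (K * siteWeight L j) := by gcongr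
      _ ≤ siteWeight L j * (K * siteWeight L j) := by
        have := inv_sqrt_le_siteWeight (L := L) j
        have := siteWeight_nonneg (L := L) j
        gcongr
      _ = _ := by ring
  calc √(N θ : ℝ) ^ (L.length + compCount L p) *
        (1 / (N θ : ℝ) * nrm s fun g => ∑ j, listDeriv L (F θ j) g)
      ≤ √(N θ : ℝ) ^ (L.length + compCount L p) *
        (1 / (N θ : ℝ) * ∑ j, nrm s (listDeriv L (F θ j))) := by
        gcongr
        exact nrm_sum_le _ (fun j => temperate_listDeriv (hF.1 θ j) L) s
    _ = ∑ j, (√(N θ : ℝ))⁻¹ * ((√(N θ : ℝ))⁻¹ *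
      √(N θ : ℝ) ^ (L.length + compCount L p) * nrm s (listDeriv L (F θ j))) := by
        rw [hNN, Finset.mul_sum, Finset.mul_sum]
        exact Finset.sum_congr rfl fun j _ => by ring
    _ ≤ ∑ j, K * siteWeight L j ^ 2 := Finset.sum_le_sum fun j _ => h1 j
    _ ≤ K * (2 * n + 1) := by
        rw [← Finset.mul_sum]
        gcongr
        refine (sum_siteWeight_sq_le L).trans ?_
        have : (L.length : ℝ) ≤ n := by exact_mod_cast hL
        linarith

theorem sum_eq_sum_star {M : ℕ} (p : Fin M) {φ : Fin M → ℝ} (h : φ p = 0) :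
    ∑ j, φ j = ∑ l : {j : Fin M // j ≠ p}, φ l.1 := by
  rw [← Finset.sum_subtype (Finset.univ.filter (· ≠ p)) (by simp) φ, Finset.sum_filter]
  refine Finset.sum_congr rfl fun j _ => ?_
  split_ifs with hj
  · rfl
  · rw [not_not.1 hj, h]

theorem sum_siteDeriv_eq {M : ℕ} (p : Fin M) (f : Fin M → Disorder M → ℝ) (g : Disorder M) :
    ∑ j, siteDeriv p j (f j) g =
      ∑ l : {j : Fin M // j ≠ p}, pd (star p l) (f l.1) g := by
  rw [sum_eq_sum_star p (by simp [siteDeriv])]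
  refine Finset.sum_congr rfl fun l _ => ?_
  rw [siteDeriv, dif_pos (Ne.symm l.2)]
  rfl

theorem sum_coupling_eq {M : ℕ} (p : Fin M) (f : Fin M → ℝ) (g : Disorder M) :
    ∑ j, coupling g p j * f j = ∑ l : {j : Fin M // j ≠ p}, g (star p l) * f l.1 := by
  rw [sum_eq_sum_star p (by simp [coupling])]
  refine Finset.sum_congr rfl fun l _ => ?_
  rw [coupling, dif_pos (Ne.symm l.2)]
  rfl

theorem Good.sum_siteDeriv (hF : Good N F) :
    Good N fun θ p g => (√(N θ : ℝ))⁻¹ * ∑ j, siteDeriv p j (F θ j) g := by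
  simp_rw [sum_siteDeriv_eq]
  refine ⟨fun θ p => by have := hF.1 θ; fun_prop, fun n s => ?_⟩
  obtain ⟨K, hK0, hK⟩ := hF.2 (n + 1) s
  refine ⟨K * (2 * n + 1), by positivity, fun θ p L hL => ?_⟩
  have ht : ∀ l : {j : Fin (N θ) // j ≠ p}, (pd (star p l) (F θ l.1)).HasTemperateGrowth :=
    fun l => temperate_pd (hF.1 θ l.1) _
  rw [listDeriv_const_mul (by fun_prop), listDeriv_sum _ ht, nrm_const_mul,
    abs_of_nonneg (by positivity), List.nil_append]
  refine le_trans ?_ (sum_inv_sqrt_mul_scaled_le (p := p) (f := fun l => F θ l.1) hK0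
    (fun l => hK θ l.1) hL (fun l => star p l :: L) fun l => List.Perm.refl _)
  rw [← Finset.mul_sum, ← mul_assoc, mul_comm (√(N θ : ℝ) ^ _)]
  gcongr
  exact nrm_sum_le _ (fun l => temperate_listDeriv (ht l) L) s

theorem Good.sum_coupling (hF : Good N F) :
    Good N fun θ p g => (√(N θ : ℝ))⁻¹ * ∑ j, coupling g p j * F θ j g := by
  simp_rw [sum_coupling_eq]
  have ht : ∀ θ p, (fun g => (√(N θ : ℝ))⁻¹ * ∑ l : {j : Fin (N θ) // j ≠ p},
      g (star p l) * F θ l.1 g).HasTemperateGrowth :=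
    fun θ p => by have := hF.1 θ; fun_prop
  refine ⟨ht, fun n s => ?_⟩
  -- `n` derivatives for the list and `s + 1` for the Sobolev bound; the exponent is raised since
  -- the divergence estimate starts at `L²`.
  obtain ⟨K, hK0, hK⟩ := hF.2 (n + s + 1) (s + 1)
  obtain ⟨K', hK0', hK'⟩ := exists_scaledBdd_field n s hK0
  refine ⟨K', hK0', fun θ p L hL => ?_⟩
  refine le_trans ?_ (hK' (N θ) p (fun l => F θ l.1) (fun l => hF.1 θ l.1)
    (fun l => hK θ l.1) L hL)
  gcongr
  exact nrm_mono (temperate_listDeriv (ht θ p) L) (Nat.le_succ s)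

end Good

end TAP

namespace TAP

open GaussSpace

/-! ### The iterates and their dependence on start and disorder. -/

section Iterates

/-- The data of the iteration for deterministic starting values. -/
structure StartData where
  size : ℕ
  field : ℝ
  start : Fin size → ℝ
  abs_start_le : ∀ i, |start i| ≤ 1

theorem iterate_add_two {N : ℕ} (c : OnsagerChoice) (β h : ℝ) (m : Fin N → ℝ) (k : ℕ)
    (g : Disorder N) (p : Fin N) :
    iterate c β h m (k + 1 + 1) g p = Real.tanh (h +
      (β * ((√(N : ℝ))⁻¹ * ∑ j, coupling g p j * iterate c β h m (k + 1) g j) +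
        (-1) * onsager c β (iterate c β h m k) (iterate c β h m (k + 1)) g p)) := by
  have key : ∀ a b x : ℝ, h + (β / x * a - b) = h + (β * (x⁻¹ * a) + (-1) * b) := by
    intro a b x; ring
  rw [iterate]
  exact congrArg Real.tanh (key _ _ _)

/-- Two consecutive iterates are carried along because of the memory term. Taking all starting data
as the index set makes the constants uniform in size, field and start. -/
theorem good_iterate (c : OnsagerChoice) (β : ℝ) (k : ℕ) :
    Good StartData.size fun θ p g => iterate c β θ.field θ.start k g p := by
  suffices h : Good StartData.size (fun θ p g => iterate c β θ.field θ.start k g p) ∧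
      Good StartData.size (fun θ p g => iterate c β θ.field θ.start (k + 1) g p) from h.1
  induction k with
  | zero =>
    exact ⟨good_const (N := StartData.size) (a := fun _ _ => 0) le_rfl fun _ _ => abs_zero.le,
      good_const (N := StartData.size) (a := StartData.start) zero_le_one
        StartData.abs_start_le⟩
  | succ k ih =>
    refine ⟨ih.2, ?_⟩
    have hons : Good StartData.size fun θ p g =>
        onsager c β (iterate c β θ.field θ.start k) (iterate c β θ.field θ.start (k + 1)) g p := by
      cases c with
      | classical =>
        have h1 := ((good_const (N := StartData.size) (a := fun _ _ => 1) zero_le_one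
          fun _ _ => abs_one.le).add ((ih.2.mul ih.2).average.const_mul (-1))).mul ih.1
        convert! h1.const_mul (β ^ 2) using 4 with θ p g
        simp only [onsager, sq]; ring
      | recentering =>
        convert! ih.2.sum_siteDeriv.const_mul β using 4 with θ p g
        simp only [onsager]; ring
    simp_rw [iterate_add_two]
    exact ((ih.2.sum_coupling.const_mul β).add (hons.const_mul (-1))).tanh StartData.field

variable {N : ℕ}

/-- Smoothness jointly in a parameter and the disorder; it supplies measurability once the start is
random. -/
theorem contDiff_partialDeriv {X : Type*} [NormedAddCommGroup X] [NormedSpace ℝ X]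
    {F : X → Disorder N → ℝ}
    (hF : ContDiff ℝ ((⊤ : ℕ∞) : WithTop ℕ∞) fun z : X × Disorder N => F z.1 z.2) (e : Pair N) :
    ContDiff ℝ ((⊤ : ℕ∞) : WithTop ℕ∞) fun z : X × Disorder N =>
      partialDeriv e (F z.1) z.2 := by
  have h1 : (fun z : X × Disorder N => partialDeriv e (F z.1) z.2) =
      fun z => fderiv ℝ (fun z : X × Disorder N => F z.1 z.2) z (0, Pi.single e 1) := by
    funext z
    have h2 := ((hF.differentiable (by simp) z).hasFDerivAt.hasLineDerivAt
      ((0 : X), (Pi.single e 1 : Disorder N)))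
    refine HasLineDerivAt.lineDeriv ?_
    simpa [HasLineDerivAt] using h2
  rw [h1]
  exact (hF.fderiv_right (by simp)).clm_apply contDiff_const

theorem contDiff_listDeriv {X : Type*} [NormedAddCommGroup X] [NormedSpace ℝ X]
    {F : X → Disorder N → ℝ}
    (hF : ContDiff ℝ ((⊤ : ℕ∞) : WithTop ℕ∞) fun z : X × Disorder N => F z.1 z.2)
    (L : List (Pair N)) :
    ContDiff ℝ ((⊤ : ℕ∞) : WithTop ℕ∞) fun z : X × Disorder N => listDeriv L (F z.1) z.2 := by
  induction L generalizing F with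
  | nil => exact hF
  | cons e L ih => exact ih (F := fun x => pd e (F x)) (contDiff_partialDeriv hF e)

theorem contDiff_iterate (c : OnsagerChoice) (β h : ℝ) (k : ℕ) (p : Fin N) :
    ContDiff ℝ ((⊤ : ℕ∞) : WithTop ℕ∞) fun z : (Fin N → ℝ) × Disorder N =>
      iterate c β h z.1 k z.2 p := by
  suffices H : (∀ p, ContDiff ℝ ((⊤ : ℕ∞) : WithTop ℕ∞) fun z : (Fin N → ℝ) × Disorder N =>
      iterate c β h z.1 k z.2 p) ∧ ∀ p, ContDiff ℝ ((⊤ : ℕ∞) : WithTop ℕ∞)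
        fun z : (Fin N → ℝ) × Disorder N => iterate c β h z.1 (k + 1) z.2 p from H.1 p
  clear p
  induction k with
  | zero =>
    refine ⟨fun p => contDiff_const, fun p => ?_⟩
    simp only [iterate]
    fun_prop
  | succ k ih =>
    refine ⟨ih.2, fun p => ?_⟩
    have hm := ih.2
    have hp := ih.1 p
    simp only [iterate]
    refine temperate_tanh.1.comp (contDiff_const.add (ContDiff.sub ?_ ?_))
    · refine contDiff_const.mul (ContDiff.sum fun j _ => ContDiff.mul ?_ (hm j))
      unfold coupling
      split_ifs <;> fun_prop
    · cases c with
      | classical => simp only [onsager]; fun_prop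
      | recentering =>
        simp only [onsager]
        refine contDiff_const.mul (ContDiff.sum fun j _ => ?_)
        unfold siteDeriv
        split_ifs with hpj
        · exact contDiff_partialDeriv (F := fun x g => iterate _ β h x (k + 1) g j) (hm j) _
        · exact contDiff_const

/-- A list of pairs that contains every pair as often as the multi-index says. -/
noncomputable def MultiIndex.toList (α : MultiIndex N) : List (Pair N) :=
  -- Reversed because `foldr` applies the last pair first, whereas `listDeriv` applies the head
  -- first.
  (Finset.univ : Finset (Pair N)).toList.reverse.flatMap fun e => List.replicate (α e) e

theorem MultiIndex.length_toList (α : MultiIndex N) : α.toList.length = order α := by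
  rw [MultiIndex.toList, List.length_flatMap, order, ← Finset.sum_map_toList,
    List.map_reverse, List.sum_reverse]
  simp

theorem MultiIndex.mem_toList {α : MultiIndex N} {e : Pair N} : e ∈ α.toList ↔ 0 < α e := by
  simp [MultiIndex.toList, List.mem_replicate, Nat.pos_iff_ne_zero]

theorem iterate_partialDeriv_eq (e : Pair N) (n : ℕ) (F : Disorder N → ℝ) :
    (partialDeriv e)^[n] F = listDeriv (List.replicate n e) F := by
  induction n generalizing F with
  | zero => rfl
  | succ n ih => rw [Function.iterate_succ_apply, ih, List.replicate_succ, listDeriv_cons]; rfl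

theorem multiDeriv_eq_listDeriv (α : MultiIndex N) (F : Disorder N → ℝ) :
    multiDeriv α F = listDeriv α.toList F := by
  unfold multiDeriv MultiIndex.toList
  induction (Finset.univ : Finset (Pair N)).toList with
  | nil => rfl
  | cons e l ih =>
    rw [List.foldr_cons, ih, List.reverse_cons, List.flatMap_append, listDeriv_append,
      iterate_partialDeriv_eq]
    simp

/-- The scaled derivatives of the iterates have bounded moments, for deterministic starting
values. -/
theorem exists_integral_multiDeriv_pow_le (c : OnsagerChoice) (β : ℝ) (t k n : ℕ) :
    ∃ C : ℝ, 0 < C ∧ ∀ (N : ℕ) (h : ℝ) (m : Fin N → ℝ), (∀ i, |m i| ≤ 1) →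
      ∀ (p : Fin N) (α : MultiIndex N), order α = n →
        Integrable (fun g => (√(N : ℝ) ^ (n + componentsAvoiding α p) *
          multiDeriv α (fun g => iterate c β h m k g p) g) ^ (2 * t)) (stdMeasure (Pair N)) ∧
        ∫ g, (√(N : ℝ) ^ (n + componentsAvoiding α p) *
          multiDeriv α (fun g => iterate c β h m k g p) g) ^ (2 * t) ∂stdMeasure (Pair N)
            ≤ C := by
  obtain ⟨hT, hB⟩ := good_iterate c β k
  -- The dyadic exponent `2 ^ (2t)` exceeds `2t`, and `x ^ (2t) ≤ 1 + |x| ^ 2 ^ (2t)` compares the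
  -- moments.
  obtain ⟨K, hK0, hK⟩ := hB n (2 * t)
  refine ⟨1 + K ^ 2 ^ (2 * t), by positivity, ?_⟩
  intro N h m hm p α hα
  have hN := one_le_sqrt_card p
  have hF := hT ⟨N, h, m, hm⟩ p
  simp only at hF
  set F : Disorder N → ℝ := fun g => iterate c β h m k g p
  set X : Disorder N → ℝ := fun g => √(N : ℝ) ^ (n + componentsAvoiding α p) * multiDeriv α F g
    with hX
  have hDt : (multiDeriv α F).HasTemperateGrowth := by
    rw [multiDeriv_eq_listDeriv]; exact temperate_listDeriv hF _
  have hXt : X.HasTemperateGrowth := by rw [hX]; fun_prop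
  have hXi : Integrable (fun g => X g ^ (2 * t)) (stdMeasure (Pair N)) :=
    integrable_of_temperate (by fun_prop)
  refine ⟨hXi, ?_⟩
  have hnrm : nrm (2 * t) X ≤ K := by
    have h1 := hK ⟨N, h, m, hm⟩ p α.toList (by rw [MultiIndex.length_toList, hα])
    rw [hX, nrm_const_mul, abs_of_nonneg (by positivity), multiDeriv_eq_listDeriv]
    refine le_trans (mul_le_mul_of_nonneg_right ?_ (nrm_nonneg _ _)) h1
    refine pow_le_pow_right₀ hN ?_
    rw [List.nil_append, MultiIndex.length_toList, hα]
    exact Nat.add_le_add_left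
      (componentsAvoiding_le_compCount (fun e => MultiIndex.mem_toList) p) n
  have hpt : ∀ g, X g ^ (2 * t) ≤ 1 + |X g| ^ 2 ^ (2 * t) := by
    intro g
    rw [← (even_two_mul t).pow_abs]
    rcases le_total |X g| 1 with h1 | h1
    · exact (pow_le_one₀ (abs_nonneg _) h1).trans (le_add_of_nonneg_right (by positivity))
    · exact (pow_le_pow_right₀ h1 Nat.lt_two_pow_self.le).trans
        (le_add_of_nonneg_left zero_le_one)
  have hpi : Integrable (fun g => |X g| ^ 2 ^ (2 * t)) (stdMeasure (Pair N)) := by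
    have := (memLp_of_temperate hXt (q := ((2 ^ (2 * t) : ℕ) : ENNReal))
      (ENNReal.natCast_ne_top _)).integrable_norm_pow (by positivity)
    simpa [Real.norm_eq_abs] using this
  refine (integral_mono hXi ((integrable_const 1).add hpi) hpt).trans ?_
  rw [integral_add' (integrable_const 1) hpi, ← nrm_pow hXt]
  simp only [integral_const, probReal_univ, smul_eq_mul, mul_one]
  gcongr
  exact nrm_nonneg _ _

end Iterates

end TAP

/-! ### Passage to random starting values. -/

theorem theorem4p1 (c : TAP.OnsagerChoice) (β : ℝ) (t k n : ℕ) (ht : 1 ≤ t) (hk : 1 ≤ k) :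
    ∃ C : ℝ, 0 < C ∧
      ∀ (N : ℕ) (Ω : Type*) [MeasurableSpace Ω] (P : Measure Ω) [IsProbabilityMeasure P]
        (G : TAP.Pair N → Ω → ℝ) (m₁ : Ω → Fin N → ℝ),
        (∀ e, HasLaw (G e) (gaussianReal 0 1) P) →
        iIndepFun G P →
        Measurable m₁ →
        (∀ ω i, m₁ ω i ∈ Set.Icc (-1 : ℝ) 1) →
        IndepFun (fun ω e => G e ω) m₁ P →
        ∀ (h : ℝ) (p : Fin N) (α : TAP.MultiIndex N), TAP.order α = n →
          (∀ ω, ContDiff ℝ ((⊤ : ℕ∞) : WithTop ℕ∞) (fun g => TAP.iterate c β h (m₁ ω) k g p)) ∧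
          Integrable (fun ω =>
            (Real.sqrt N ^ (n + TAP.componentsAvoiding α p) *
              TAP.multiDeriv α (fun g => TAP.iterate c β h (m₁ ω) k g p) (fun e => G e ω))
                ^ (2 * t)) P ∧
          ∫ ω, (Real.sqrt N ^ (n + TAP.componentsAvoiding α p) *
              TAP.multiDeriv α (fun g => TAP.iterate c β h (m₁ ω) k g p) (fun e => G e ω))
                ^ (2 * t) ∂P ≤ C := by
  obtain ⟨C, hC0, hC⟩ := TAP.exists_integral_multiDeriv_pow_le c β t k n
  refine ⟨C, hC0, ?_⟩
  intro N Ω _ P _ G m₁ hG hGi hm hm1 hind h p α hα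
  refine ⟨fun ω => (TAP.contDiff_iterate c β h k p).comp (contDiff_const.prodMk contDiff_id), ?_⟩
  have hGm : ∀ e, AEMeasurable (G e) P := fun e => (hG e).aemeasurable
  have hGm' : AEMeasurable (fun ω e => G e ω) P := aemeasurable_pi_lambda _ hGm
  have hGlaw : P.map (fun ω e => G e ω) = GaussSpace.stdMeasure (TAP.Pair N) := by
    rw [(iIndepFun_iff_map_fun_eq_pi_map hGm).1 hGi, GaussSpace.stdMeasure]
    simp_rw [(hG _).map_eq]
  -- Independence makes the joint law a product, so the bound for fixed starts can be integrated
  -- over the law of `m₁`.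
  have hpair : P.map (fun ω => (m₁ ω, fun e => G e ω)) =
      (P.map m₁).prod (GaussSpace.stdMeasure (TAP.Pair N)) := by
    rw [← hGlaw]
    exact (indepFun_iff_map_prod_eq_prod_map_map hm.aemeasurable hGm').1 hind.symm
  have hpm : AEMeasurable (fun ω => (m₁ ω, fun e => G e ω)) P := hm.aemeasurable.prodMk hGm'
  set Ψ : (Fin N → ℝ) × TAP.Disorder N → ℝ := fun z =>
    (Real.sqrt N ^ (n + TAP.componentsAvoiding α p) *
      TAP.multiDeriv α (fun g => TAP.iterate c β h z.1 k g p) z.2) ^ (2 * t) with hΨ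
  have hΨc : Continuous Ψ := by
    simp only [hΨ, TAP.multiDeriv_eq_listDeriv]
    exact (continuous_const.mul (TAP.contDiff_listDeriv
      (F := fun x g => TAP.iterate c β h x k g p)
      (TAP.contDiff_iterate c β h k p) _).continuous).pow _
  have hΨ0 : ∀ z, 0 ≤ Ψ z := fun z => (even_two_mul t).pow_nonneg _
  have hcube : ∀ᵐ m ∂P.map m₁, ∀ i, |m i| ≤ 1 := by
    rw [ae_map_iff hm.aemeasurable]
    · exact ae_of_all _ fun ω i => abs_le.2 (hm1 ω i)
    · rw [Set.ofPred_forall]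
      exact (isClosed_iInter fun i => isClosed_le (continuous_apply i).abs
        continuous_const).measurableSet
  have hprob : IsProbabilityMeasure (P.map m₁) := Measure.isProbabilityMeasure_map hm.aemeasurable
  have hint : Integrable Ψ ((P.map m₁).prod (GaussSpace.stdMeasure (TAP.Pair N))) := by
    rw [integrable_prod_iff hΨc.aestronglyMeasurable]
    refine ⟨?_, ?_⟩
    · filter_upwards [hcube] with m hmc using (hC N h m hmc p α hα).1
    · refine Integrable.of_bound (C := C)
        (hΨc.norm.aestronglyMeasurable.integral_prod_right') ?_
      filter_upwards [hcube] with m hmc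
      rw [Real.norm_of_nonneg (integral_nonneg fun _ => norm_nonneg _)]
      simp_rw [Real.norm_of_nonneg (hΨ0 _)]
      exact (hC N h m hmc p α hα).2
  have hint' : Integrable Ψ (P.map fun ω => (m₁ ω, fun e => G e ω)) := by rwa [hpair]
  refine ⟨(integrable_map_measure hΨc.aestronglyMeasurable hpm).1 hint', ?_⟩
  have h1 : ∫ ω, Ψ (m₁ ω, fun e => G e ω) ∂P =
      ∫ m, ∫ g, Ψ (m, g) ∂GaussSpace.stdMeasure (TAP.Pair N) ∂P.map m₁ := by
    rw [← integral_prod _ hint, ← hpair, integral_map hpm hΨc.aestronglyMeasurable]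
  refine h1.trans_le ?_
  calc ∫ m, ∫ g, Ψ (m, g) ∂GaussSpace.stdMeasure (TAP.Pair N) ∂P.map m₁
      ≤ ∫ _, C ∂P.map m₁ := by
        refine integral_mono_ae hint.integral_prod_left (integrable_const C) ?_
        filter_upwards [hcube] with m hmc using (hC N h m hmc p α hα).2
    _ = C := by simp
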